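/- Let $m\ge 0$, let $\kappa>0$, and let $\chi_\ell\in\mathbf C^m$ $(\ell\ge 0)$ satisfy $\sum_\ell\Vert\chi_\ell\Vert<\infty$. For $\Re z\ge 0$ let $$\psi(z)=\sum_{\ell=0}^\infty \chi_\ell\, e^{-(\kappa+\ell+1/2)z},\qquad \Psi(z)=\begin{bmatrix}0&\psi(z)\\ \psi(\bar z)^\dagger&0\end{bmatrix}\in M_{m+1}(\mathbf C),$$ and let $\sigma\in M_{m+1}(\mathbf C)$ be a constant matrix. Let $\Omega=\{s:\Re s>0\}$. For $\Re s\ge 0$ and $x>0$ let $\Psi_{(s)}(x)=\Psi(x+2s)$ and $\Psi^*_{(s)}(x)=\Psi(x+2\bar s)^\dagger$, let $\Gamma_\varphi f(x)=\int_0^\infty\varphi(x+y)f(y)\,dy$ denote the Hankel operator on $L^2((0,\infty);\mathbf C^{m+1})$ with symbol $\varphi$, and let $$K_s=\Gamma_{\Psi^*_{(s)}}\,\sigma\,\Gamma_{\Psi_{(s)}},\qquad K=K_0 .$$ Then for all $s$ with $\Re s\ge 0$ these Hankel operators are bounded and $K_s$ is of trace class. Write $\tau(2s)=\det(I-K_s)$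 (Fredholm determinant), and let $P_{(t,\infty)}$ be the projection $f\mapsto \mathbf 1_{(t,\infty)}f$. Norms of matrices are operator norms on Euclidean space. (i) The function $s\mapsto\tau(2s)$ is analytic on $\Omega$, and for real $s>0$ the operator $P_{(2s,\infty)}K$ is of trace class with $\tau(2s)=\det(I-P_{(2s,\infty)}K)$. (ii) The zeros of $\tau(2s)$ in $\Omega$ are isolated, and $q(s)=-2\frac{d^2}{ds^2}\log\tau(2s)$ is meromorphic on $\Omega$. If $s\in\Omega$ and $\Vert\sigma\Vert\int_0^\infty x\Vert\Psi(x+2s)\Vert^2dx<1$, then $\tau(2s)\ne 0$ and $q$ is analytic at $s$. The same holds if $s>0$ is real and $\Vert\sigma\Vert\int_0^\infty x\Vert\Psi(x+s)\Vert^2dx<1$. (If $\Vert\sigma\Vert\le 1$, the factor $\Vert\sigma\Vert$ may be omitted from both conditions.) (iii) If $0\le K\le I$, then $\tau(t)$ is real and non-negative for $0<t<\infty$, is a non-decreasing function of $t$ there, and $\tau(t)\to 1$ as $t\to\infty$. -/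

import Mathlib

open MeasureTheory Set Filter Topology

noncomputable section

/-! ## Trace class operators and the Fredholm determinant -/

/-- `T` is of trace class: it has a nuclear expansion `T x = ∑ₖ ⟪bₖ, x⟫ aₖ` with
`∑ₖ ‖aₖ‖ ‖bₖ‖ < ∞`. -/
def IsTraceClass {H : Type*} [NormedAddCommGroup H] [InnerProductSpace ℂ H]
    (T : H →L[ℂ] H) : Prop :=
  ∃ a b : ℕ → H, Summable (fun k => ‖a k‖ * ‖b k‖) ∧
    ∀ x : H, HasSum (fun k => inner ℂ (b k) x • a k) (T x)

/-- The principal minor of the matrix `(⟪eᵢ, T eⱼ⟫)` of `T` on the finite set `F` of indices. The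
sum of these over all `F` with `k` elements is the trace of the exterior power `Λᵏ T`. -/
def principalMinor {H : Type*} [NormedAddCommGroup H] [InnerProductSpace ℂ H] {ι : Type*}
    (e : HilbertBasis ι ℂ H) (T : H →L[ℂ] H) (F : Finset ι) : ℂ :=
  by classical exact (Matrix.of fun i j : F => inner ℂ (e i) (T (e j))).det

/-- `d` is the Fredholm determinant `det (I - T) = ∑ₖ (-1)ᵏ trace (Λᵏ T)` of the trace class
operator `T`. The expansion, written as an unordered sum of principal minors, is required to
converge to `d` in every orthonormal basis. -/
def HasFredholmDet.{u} {H : Type u} [NormedAddCommGroup H] [InnerProductSpace ℂ H]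
    (T : H →L[ℂ] H) (d : ℂ) : Prop :=
  IsTraceClass T ∧ ∀ (ι : Type u) (e : HilbertBasis ι ℂ H),
    HasSum (fun F : Finset ι => (-1 : ℂ) ^ F.card * principalMinor e T F) d

open Classical in
/-- The Fredholm determinant `det (I - T)`. -/
def fredholmDet {H : Type*} [NormedAddCommGroup H] [InnerProductSpace ℂ H]
    (T : H →L[ℂ] H) : ℂ :=
  if h : ∃ d, HasFredholmDet T d then h.choose else 0

theorem HasFredholmDet.unique {H : Type*} [NormedAddCommGroup H] [InnerProductSpace ℂ H]
    [CompleteSpace H] {T : H →L[ℂ] H} {d d' : ℂ} (h : HasFredholmDet T d)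
    (h' : HasFredholmDet T d') : d = d' := by
  obtain ⟨w, e, -⟩ := exists_hilbertBasis ℂ H
  exact (h.2 w e).unique (h'.2 w e)

theorem HasFredholmDet.fredholmDet_eq {H : Type*} [NormedAddCommGroup H] [InnerProductSpace ℂ H]
    [CompleteSpace H] {T : H →L[ℂ] H} {d : ℂ} (h : HasFredholmDet T d) : fredholmDet T = d := by
  have hex : ∃ d, HasFredholmDet T d := ⟨d, h⟩
  rw [fredholmDet, dif_pos hex]
  exact hex.choose_spec.unique h

/-! ## Operators on `L²((0, ∞); ℂⁿ)` -/

/-- The Hilbert space `L²((0, ∞); ℂⁿ)`, where `n` is a finite index type. -/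
abbrev L2HalfLine (n : Type) [Fintype n] : Type :=
  Lp (EuclideanSpace ℂ n) 2 (volume.restrict (Ioi (0 : ℝ)))

/-- A matrix acting on the Euclidean space `ℂⁿ`. -/
abbrev matCLM {n : Type} [Fintype n] [DecidableEq n] (A : Matrix n n ℂ) :
    EuclideanSpace ℂ n →L[ℂ] EuclideanSpace ℂ n :=
  Matrix.toEuclideanCLM (n := n) (𝕜 := ℂ) A

/-- `G` is the Hankel operator with symbol `φ`: `G f (x) = ∫₀^∞ φ (x + y) f (y) dy`, the integral
being absolutely convergent for almost every `x`. -/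
def IsHankelOp {n : Type} [Fintype n] [DecidableEq n] (φ : ℝ → Matrix n n ℂ)
    (G : L2HalfLine n →L[ℂ] L2HalfLine n) : Prop :=
  ∀ f : L2HalfLine n, ∀ᵐ x ∂(volume.restrict (Ioi (0 : ℝ))),
    IntegrableOn (fun y : ℝ => matCLM (φ (x + y)) (f y)) (Ioi (0 : ℝ)) ∧
      G f x = ∫ y in Ioi (0 : ℝ), matCLM (φ (x + y)) (f y)

theorem IsHankelOp.unique {n : Type} [Fintype n] [DecidableEq n] {φ : ℝ → Matrix n n ℂ}
    {G G' : L2HalfLine n →L[ℂ] L2HalfLine n} (h : IsHankelOp φ G) (h' : IsHankelOp φ G') :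
    G = G' := by
  ext1 f
  apply Lp.ext
  filter_upwards [h f, h' f] with x hx hx'
  rw [hx.2, hx'.2]

open Classical in
/-- The Hankel operator `Γ_φ` (zero if `φ` does not define a bounded operator). -/
def hankelOp {n : Type} [Fintype n] [DecidableEq n] (φ : ℝ → Matrix n n ℂ) :
    L2HalfLine n →L[ℂ] L2HalfLine n :=
  if h : ∃ G, IsHankelOp φ G then h.choose else 0

theorem IsHankelOp.hankelOp_eq {n : Type} [Fintype n] [DecidableEq n] {φ : ℝ → Matrix n n ℂ}
    {G : L2HalfLine n →L[ℂ] L2HalfLine n} (h : IsHankelOp φ G) : hankelOp φ = G := by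
  have hex : ∃ G, IsHankelOp φ G := ⟨G, h⟩
  rw [hankelOp, dif_pos hex]
  exact hex.choose_spec.unique h

/-- Multiplication by a constant matrix, `f ↦ A f`. -/
def constMulOp {n : Type} [Fintype n] [DecidableEq n] (A : Matrix n n ℂ) :
    L2HalfLine n →L[ℂ] L2HalfLine n :=
  (matCLM A).compLpL 2 (volume.restrict (Ioi (0 : ℝ)))

/-- The function `1_{(t, ∞)} f`. -/
def cutoffFun {n : Type} [Fintype n] (t : ℝ) (f : L2HalfLine n) : L2HalfLine n :=
  ((Lp.memLp f).indicator (measurableSet_Ioi (a := t))).toLp _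

theorem coeFn_cutoffFun {n : Type} [Fintype n] (t : ℝ) (f : L2HalfLine n) :
    cutoffFun t f =ᵐ[volume.restrict (Ioi (0 : ℝ))] (Ioi t).indicator f :=
  MemLp.coeFn_toLp _

theorem cutoffFun_add {n : Type} [Fintype n] (t : ℝ) (f g : L2HalfLine n) :
    cutoffFun t (f + g) = cutoffFun t f + cutoffFun t g := by
  apply Lp.ext
  filter_upwards [coeFn_cutoffFun t (f + g), Lp.coeFn_add (cutoffFun t f) (cutoffFun t g),
    Lp.coeFn_add f g, coeFn_cutoffFun t f, coeFn_cutoffFun t g] with x h1 h2 h3 h4 h5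
  rw [h1, h2, Pi.add_apply, h4, h5]
  by_cases hx : x ∈ Ioi t
  · rw [indicator_of_mem hx, indicator_of_mem hx, indicator_of_mem hx, h3, Pi.add_apply]
  · rw [indicator_of_notMem hx, indicator_of_notMem hx, indicator_of_notMem hx, add_zero]

theorem cutoffFun_smul {n : Type} [Fintype n] (t : ℝ) (c : ℂ) (f : L2HalfLine n) :
    cutoffFun t (c • f) = c • cutoffFun t f := by
  apply Lp.ext
  filter_upwards [coeFn_cutoffFun t (c • f), Lp.coeFn_smul c (cutoffFun t f),
    Lp.coeFn_smul c f, coeFn_cutoffFun t f] with x h1 h2 h3 h4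
  rw [h1, h2, Pi.smul_apply, h4]
  by_cases hx : x ∈ Ioi t
  · rw [indicator_of_mem hx, indicator_of_mem hx, h3, Pi.smul_apply]
  · rw [indicator_of_notMem hx, indicator_of_notMem hx, smul_zero]

theorem norm_cutoffFun_le {n : Type} [Fintype n] (t : ℝ) (f : L2HalfLine n) :
    ‖cutoffFun t f‖ ≤ ‖f‖ := by
  apply Lp.norm_le_norm_of_ae_le
  filter_upwards [coeFn_cutoffFun t f] with x h
  rw [h]
  exact norm_indicator_le_norm_self _ _

/-- The orthogonal projection `P_{(t, ∞)} : f ↦ 1_{(t, ∞)} f`. -/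
def cutoffProj (n : Type) [Fintype n] (t : ℝ) : L2HalfLine n →L[ℂ] L2HalfLine n :=
  LinearMap.mkContinuous
    { toFun := cutoffFun t
      map_add' := cutoffFun_add t
      map_smul' := cutoffFun_smul t }
    1 (fun f => (norm_cutoffFun_le t f).trans_eq (one_mul _).symm)

/-! ## The scattering function and the tau function -/

/-- The scattering function `ψ (z) = ∑ₗ e^{-(κ + l + 1/2) z} χₗ`. -/
def scatteringFun {m : ℕ} (κ : ℝ) (χ : ℕ → EuclideanSpace ℂ (Fin m)) (z : ℂ) :
    EuclideanSpace ℂ (Fin m) :=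
  ∑' l : ℕ, Complex.exp (-((κ : ℂ) + (l : ℂ) + 1 / 2) * z) • χ l

/-- The block matrix function `Ψ (z)` with zero diagonal blocks, upper right block the column
`ψ (z)`, and lower left block the row `ψ (z̄)†`. -/
def symbolMat {m : ℕ} (κ : ℝ) (χ : ℕ → EuclideanSpace ℂ (Fin m)) (z : ℂ) :
    Matrix (Fin m ⊕ Unit) (Fin m ⊕ Unit) ℂ :=
  Matrix.fromBlocks 0
    (Matrix.of fun i _ => scatteringFun κ χ z i)
    (Matrix.of fun _ j => star (scatteringFun κ χ (star z) j))
    0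

/-- `Ψ_{(s)} (x) = Ψ (x + 2 s)`. -/
def shiftedSymbol {m : ℕ} (κ : ℝ) (χ : ℕ → EuclideanSpace ℂ (Fin m)) (s : ℂ) (x : ℝ) :
    Matrix (Fin m ⊕ Unit) (Fin m ⊕ Unit) ℂ :=
  symbolMat κ χ ((x : ℂ) + 2 * s)

/-- `Ψ*_{(s)} (x) = Ψ (x + 2 s̄)†`. -/
def shiftedSymbolStar {m : ℕ} (κ : ℝ) (χ : ℕ → EuclideanSpace ℂ (Fin m)) (s : ℂ) (x : ℝ) :
    Matrix (Fin m ⊕ Unit) (Fin m ⊕ Unit) ℂ :=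
  (symbolMat κ χ ((x : ℂ) + 2 * star s)).conjTranspose

/-- `K_s = Γ_{Ψ*_{(s)}} σ Γ_{Ψ_{(s)}}`; the operator `K` is `K_0`. -/
def kernelOp {m : ℕ} (κ : ℝ) (χ : ℕ → EuclideanSpace ℂ (Fin m))
    (σ : Matrix (Fin m ⊕ Unit) (Fin m ⊕ Unit) ℂ) (s : ℂ) :
    L2HalfLine (Fin m ⊕ Unit) →L[ℂ] L2HalfLine (Fin m ⊕ Unit) :=
  hankelOp (shiftedSymbolStar κ χ s) ∘L constMulOp σ ∘L hankelOp (shiftedSymbol κ χ s)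

/-- The tau function, normalised so that `τ (2 s) = det (I - K_s)`. -/
def tauFun {m : ℕ} (κ : ℝ) (χ : ℕ → EuclideanSpace ℂ (Fin m))
    (σ : Matrix (Fin m ⊕ Unit) (Fin m ⊕ Unit) ℂ) (z : ℂ) : ℂ :=
  fredholmDet (kernelOp κ χ σ (z / 2))

/-- The potential `q (s) = -2 d²/ds² log τ (2 s)`; the derivative of any branch of the logarithm
is the logarithmic derivative. -/
def potential {m : ℕ} (κ : ℝ) (χ : ℕ → EuclideanSpace ℂ (Fin m))
    (σ : Matrix (Fin m ⊕ Unit) (Fin m ⊕ Unit) ℂ) (s : ℂ) : ℂ :=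
  -2 * deriv (logDeriv fun z : ℂ => tauFun κ χ σ (2 * z)) s

end

section FiniteMatrices

open scoped ComplexOrder Matrix

/-! ## Determinants of finite matrices -/

/-! With λ_l = κ + l + 1/2, let E_l v = e^{-λ_l x} v and let X_l be the block matrix built from χ_l.
The Hankel operator of Ψ_{(s)} is Γ_s = ∑ e^{-2sλ_l} E_l X_l E_l†, absolutely convergent because
‖E_l‖² = 1/(2λ_l) ≤ 1, and holomorphic in s for Re s > 0. Since Ψ(z̄)† = Ψ(z), the starred symbol is
the same one and K_s = Γ_s σ Γ_s, which has an explicit nuclear expansion ∑ ⟪b_k, ·⟫ a_k.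

The determinant is computed as `nuclearDet`, the sum of (-1)^|G| det(⟪b_i, a_j⟫)_{i,j∈G} over finite
G. Hadamard's inequality `norm_det_inner_le` bounds each term by ∏_{k∈G} ‖a_k‖‖b_k‖, so the series
converges absolutely. Comparing det(1 - AB) with det(1 - BA) identifies it with the sum of principal
minors in every orthonormal basis. Dominated convergence gives analyticity of τ and τ → 1; the
identity theorem then isolates the zeros.

For the cut-off, E_l'† P_{(t,∞)} E_l = e^{-(λ_l+λ_l')t}/(λ_l+λ_l'), so the cut-off inserted between
two Hankel operators merely shifts both symbols. Hence PK and K_s have the same matrix (⟪b_i, a_j⟫),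
and the same determinant (`hasFredholmDet_cutoff`).

Non-vanishing: if I - T is invertible then det(I - T) ≠ 0, and ‖K_s‖ ≤ ‖σ‖‖Γ_s‖², where ‖Γ_s‖² is at
most the Hilbert-Schmidt integral ∫ x‖Ψ(x+2s)‖² dx.

Monotonicity: in a basis adapted to P_{(t',∞)}, the finite determinants for t' are principal minors
of those for t. A positive semidefinite matrix M ≤ 1 has determinant at most any of its principal
minors, by Schur complements. -/

theorem Matrix.det_one_sub_eq_sum_minors {n : Type*} [Fintype n] [DecidableEq n]
    (M : Matrix n n ℂ) :
    (1 - M).det = ∑ s : Finset n, (-1) ^ s.card *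
      (M.submatrix (Subtype.val : s → n) (Subtype.val : s → n)).det := by
  -- Multilinearity in the rows: each row of 1 - M is a row of -M plus a row of 1, and the rows
  -- taken from 1 cut the determinant down to a principal minor.
  have h : (1 - M).det = Matrix.detRowAlternating
      ((fun i => (-M) i) + fun i => (1 : Matrix n n ℂ) i) := by
    rw [sub_eq_neg_add]; rfl
  rw [h, AlternatingMap.map_add_univ]
  refine Finset.sum_congr rfl fun s _ => ?_
  have := Matrix.det_piecewise_one_eq_submatrix_det (-M) s
  refine this.trans ?_
  rw [Matrix.submatrix_neg]
  simp [Matrix.det_neg]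

/-- The eigenvalues x ≥ 0 sum to the size of the matrix, and x ≤ e^{x-1} turns their product into an
exponential of that sum. -/
theorem Matrix.PosSemidef.norm_det_le_one_of_diag {n : Type*} [Fintype n] [DecidableEq n]
    {M : Matrix n n ℂ} (hM : M.PosSemidef) (h1 : ∀ i, M i i = 1) : ‖M.det‖ ≤ 1 := by
  have htr : ∑ i, hM.1.eigenvalues i = Fintype.card n := by
    have := hM.1.trace_eq_sum_eigenvalues
    simp only [Matrix.trace, Matrix.diag_apply, h1] at this
    simp only [Finset.sum_const, Finset.card_univ, nsmul_eq_mul, mul_one] at this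
    refine Complex.ofReal_injective ?_
    push_cast
    exact this.symm
  rw [hM.1.det_eq_prod_eigenvalues, norm_prod]
  calc ∏ i, ‖((hM.1.eigenvalues i : ℝ) : ℂ)‖ = ∏ i, hM.1.eigenvalues i :=
        Finset.prod_congr rfl fun i _ => by
          rw [Complex.norm_real, Real.norm_of_nonneg (hM.eigenvalues_nonneg i)]
    _ ≤ ∏ i, Real.exp (hM.1.eigenvalues i - 1) :=
        Finset.prod_le_prod (fun i _ => hM.eigenvalues_nonneg i) fun i _ => by
          linarith [Real.add_one_le_exp (hM.1.eigenvalues i - 1)]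
    _ = 1 := by
        rw [← Real.exp_sum, Finset.sum_sub_distrib, htr]
        simp

/-- **Hadamard's inequality** for Gram matrices. -/
theorem norm_det_gram_le {H : Type*} [NormedAddCommGroup H] [InnerProductSpace ℂ H]
    {n : Type*} [Fintype n] [DecidableEq n] (v : n → H) :
    ‖(Matrix.gram ℂ v).det‖ ≤ ∏ i, ‖v i‖ ^ 2 := by
  by_cases h0 : ∃ i, v i = 0
  · obtain ⟨i, hi⟩ := h0
    rw [Matrix.det_eq_zero_of_row_eq_zero i (fun j => by simp [Matrix.gram_apply, hi]), norm_zero]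
    positivity
  · push Not at h0
    -- Rescaling to unit vectors reduces to a Gram matrix with ones on the diagonal.
    let u : n → H := fun i => ((‖v i‖ : ℂ)⁻¹) • v i
    have hu : Matrix.gram ℂ v = Matrix.diagonal (fun i => (‖v i‖ : ℂ)) * Matrix.gram ℂ u *
        Matrix.diagonal (fun i => (‖v i‖ : ℂ)) := by
      ext i j
      have hi : (‖v i‖ : ℂ) ≠ 0 := by simpa using h0 i
      have hj : (‖v j‖ : ℂ) ≠ 0 := by simpa using h0 j
      simp only [Matrix.mul_diagonal, Matrix.diagonal_mul, Matrix.gram_apply, u, inner_smul_left,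
        inner_smul_right, map_inv₀, Complex.conj_ofReal]
      field_simp
    have h1 : ‖(Matrix.gram ℂ u).det‖ ≤ 1 := by
      refine (Matrix.posSemidef_gram ℂ u).norm_det_le_one_of_diag fun i => ?_
      have hi : ‖v i‖ ≠ 0 := by simpa using h0 i
      have hn : ‖u i‖ = 1 := by
        simp only [u, norm_smul, norm_inv, Complex.norm_real, norm_norm]
        exact inv_mul_cancel₀ hi
      rw [Matrix.gram_apply, inner_self_eq_norm_sq_to_K, hn]
      simp
    rw [hu, Matrix.det_mul, Matrix.det_mul, Matrix.det_diagonal, norm_mul, norm_mul, norm_prod,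
      Finset.prod_pow]
    simp only [Complex.norm_real, norm_norm]
    have hp : 0 ≤ ∏ i, ‖v i‖ := by positivity
    nlinarith [mul_nonneg hp hp]

/-- The Gram matrix is CᴴC for the coordinate matrix C, so its determinant is |det C|². -/
theorem norm_det_coord_le {H : Type*} [NormedAddCommGroup H] [InnerProductSpace ℂ H]
    {n : Type*} [Fintype n] [DecidableEq n] (b : OrthonormalBasis n ℂ H) (v : n → H) :
    ‖(Matrix.of fun i j => inner ℂ (b i) (v j)).det‖ ≤ ∏ i, ‖v i‖ := by
  have h := norm_det_gram_le v
  rw [Matrix.gram_eq_conjTranspose_mul b, Matrix.det_mul, Matrix.det_conjTranspose, norm_mul,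
    norm_star, Finset.prod_pow, ← sq] at h
  simp only [b.repr_apply_apply] at h
  exact le_of_sq_le_sq h (by positivity)

/-- **Hadamard's inequality** for a matrix of inner products. -/
theorem norm_det_inner_le {H : Type*} [NormedAddCommGroup H] [InnerProductSpace ℂ H]
    {n : Type*} [Fintype n] [DecidableEq n] (x y : n → H) :
    ‖(Matrix.of fun i j => inner ℂ (x i) (y j)).det‖ ≤ ∏ i, (‖x i‖ * ‖y i‖) := by
  by_cases hx : LinearIndependent ℂ x
  · let V := Submodule.span ℂ (Set.range x)
    have hV : Module.finrank ℂ V = Fintype.card n := finrank_span_eq_card hx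
    have : FiniteDimensional ℂ V := FiniteDimensional.span_of_finite ℂ (Set.finite_range x)
    let b : OrthonormalBasis n ℂ V :=
      ((stdOrthonormalBasis ℂ V).reindex (finCongr hV)).reindex (Fintype.equivFin n).symm
    let x' : n → V := fun i => ⟨x i, Submodule.subset_span ⟨i, rfl⟩⟩
    -- Projecting y onto the span of x keeps all the inner products; both families then have square
    -- coordinate matrices, and the given matrix is the product of one with the adjoint of the
    -- other.
    let y' : n → V := fun i => V.orthogonalProjectionOnto (y i)
    have hfac : (Matrix.of fun i j => inner ℂ (x i) (y j)) =
        (Matrix.of fun i j => inner ℂ (b i) (x' j)).conjTranspose *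
          (Matrix.of fun i j => inner ℂ (b i) (y' j)) := by
      ext i j
      simp only [Matrix.mul_apply, Matrix.conjTranspose_apply, Matrix.of_apply, RCLike.star_def,
        inner_conj_symm]
      rw [b.sum_inner_mul_inner]
      simp [x', y']
    rw [hfac, Matrix.det_mul, Matrix.det_conjTranspose, norm_mul, norm_star,
      Finset.prod_mul_distrib]
    refine mul_le_mul ((norm_det_coord_le b x').trans_eq rfl)
      ((norm_det_coord_le b y').trans ?_) (norm_nonneg _) (by positivity)
    exact Finset.prod_le_prod (fun i _ => norm_nonneg _)
      fun i _ => V.norm_orthogonalProjectionOnto_apply_le (y i)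
  · have : (Matrix.of fun i j => inner ℂ (x i) (y j)).det = 0 := by
      rw [Fintype.not_linearIndependent_iff] at hx
      obtain ⟨g, hg, i, hi⟩ := hx
      refine Matrix.exists_vecMul_eq_zero_iff.1 ⟨fun i => star (g i), fun h => hi ?_, ?_⟩
      · simpa using congrFun h i
      · ext j
        have := congrArg (fun z => inner ℂ z (y j)) hg
        simpa [Matrix.vecMul, dotProduct, sum_inner, inner_smul_left, mul_comm] using this
    rw [this, norm_zero]
    positivity

theorem Matrix.PosSemidef.det_re_le_one {n : Type*} [Fintype n] [DecidableEq n]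
    {M : Matrix n n ℂ} (hM : M.PosSemidef) (h1 : (1 - M).PosSemidef) : M.det.re ≤ 1 := by
  have hle : ∀ i, hM.1.eigenvalues i ≤ 1 := by
    intro i
    have hv := h1.re_dotProduct_nonneg (hM.1.eigenvectorBasis i)
    have hn : star (hM.1.eigenvectorBasis i).ofLp ⬝ᵥ (hM.1.eigenvectorBasis i).ofLp = 1 := by
      have := hM.1.eigenvectorBasis.orthonormal.1 i
      have h2 := inner_self_eq_norm_sq_to_K (𝕜 := ℂ) (hM.1.eigenvectorBasis i)
      rw [this, EuclideanSpace.inner_eq_star_dotProduct, dotProduct_comm] at h2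
      simpa using h2
    rw [Matrix.sub_mulVec, Matrix.one_mulVec, hM.1.mulVec_eigenvectorBasis, dotProduct_sub,
      dotProduct_smul, hn] at hv
    simpa using hv
  rw [hM.1.det_eq_prod_eigenvalues, ← RCLike.ofReal_prod]
  exact Finset.prod_le_one (fun i _ => hM.eigenvalues_nonneg i) fun i _ => hle i

/-- The determinant is det A times that of the Schur complement D - BᴴA⁻¹B, which lies between 0 and
D ≤ 1. -/
theorem Matrix.PosSemidef.det_fromBlocks_re_le {m n : Type*} [Fintype m] [DecidableEq m]
    [Fintype n] [DecidableEq n] {A : Matrix m m ℂ} {B : Matrix m n ℂ} {D : Matrix n n ℂ}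
    (hM : (Matrix.fromBlocks A B B.conjTranspose D).PosSemidef) (hD : (1 - D).PosSemidef) :
    (Matrix.fromBlocks A B B.conjTranspose D).det.re ≤ A.det.re := by
  have hA : A.PosSemidef := by simpa using! hM.submatrix Sum.inl
  -- A kernel vector of A, extended by zero, annihilates the quadratic form of the block matrix, so
  -- by positivity it lies in its kernel: both determinants vanish.
  by_cases hdet : A.det = 0
  · obtain ⟨v, hv, hAv⟩ := Matrix.exists_mulVec_eq_zero_iff.2 hdet
    have h0 : (Matrix.fromBlocks A B B.conjTranspose D) *ᵥ (Sum.elim v 0) = 0 := by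
      rw [← hM.dotProduct_mulVec_zero_iff]
      simp [Matrix.fromBlocks_mulVec, hAv, dotProduct]
    have : (Matrix.fromBlocks A B B.conjTranspose D).det = 0 := by
      refine Matrix.exists_mulVec_eq_zero_iff.1 ⟨Sum.elim v 0, fun h => hv ?_, h0⟩
      ext i
      simpa using congrFun h (Sum.inl i)
    rw [this, hdet]
  · have hpd : A.PosDef := hA.posDef_iff_det_ne_zero.2 hdet
    have : Invertible A := hpd.isUnit.invertible
    have hS := (Matrix.PosDef.fromBlocks₁₁ B D hpd).1 hM
    have hS1 : (1 - (D - B.conjTranspose * A⁻¹ * B)).PosSemidef := by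
      have := hD.add (hpd.inv.posSemidef.conjTranspose_mul_mul_same B)
      convert this using 1
      abel
    rw [Matrix.det_fromBlocks₁₁, Matrix.invOf_eq_nonsing_inv]
    have h1 := hS.det_re_le_one hS1
    have h2 := Complex.nonneg_iff.1 hS.det_nonneg
    have h3 := Complex.nonneg_iff.1 hA.det_nonneg
    rw [Complex.mul_re, ← h2.2, mul_zero, sub_zero]
    exact mul_le_of_le_one_right h3.1 h1

theorem Matrix.PosSemidef.det_re_le_submatrix {n : Type*} [Fintype n] [DecidableEq n]
    {M : Matrix n n ℂ} (hM : M.PosSemidef) (h1 : (1 - M).PosSemidef) (p : n → Prop)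
    [DecidablePred p] :
    M.det.re ≤
      (M.submatrix (Subtype.val : {i // p i} → n) (Subtype.val : {i // p i} → n)).det.re := by
  let e := Equiv.sumCompl p
  have hM' := hM.submatrix e
  have h1' := (h1.submatrix e).submatrix Sum.inr
  rw [← Matrix.det_submatrix_equiv_self e M]
  have hblk := (Matrix.fromBlocks_toBlocks (M.submatrix e e)).symm
  have hherm : (M.submatrix e e).toBlocks₂₁ = (M.submatrix e e).toBlocks₁₂.conjTranspose := by
    ext i j
    exact (hM'.1.apply (Sum.inr i) (Sum.inl j)).symm
  rw [hherm] at hblk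
  rw [hblk] at hM' ⊢
  refine (hM'.det_fromBlocks_re_le ?_).trans_eq rfl
  convert h1' using 1
  ext i j
  simp [Matrix.toBlocks₂₂, Matrix.one_apply, e, Subtype.ext_iff]

end FiniteMatrices

/-! ## Fredholm determinants of nuclear expansions -/

section NuclearDet

variable {H : Type*} [NormedAddCommGroup H] [InnerProductSpace ℂ H] {κ : Type*}

/-- The principal minor on `F` of a possibly infinite matrix `M`. -/
noncomputable def minorDet (M : κ → κ → ℂ) (F : Finset κ) : ℂ := by
  classical exact (Matrix.of fun i j : F => M i j).det

theorem minorDet_eq [DecidableEq κ] (M : κ → κ → ℂ) (F : Finset κ) :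
    minorDet M F = (Matrix.of fun i j : F => M i j).det := by
  rw [minorDet]
  congr!

theorem norm_minorDet_inner_le (x y : κ → H) (F : Finset κ) :
    ‖minorDet (fun i j => inner ℂ (x i) (y j)) F‖ ≤ ∏ i ∈ F, (‖x i‖ * ‖y i‖) := by
  classical
  rw [minorDet_eq, ← Finset.prod_coe_sort F]
  exact norm_det_inner_le (fun i : F => x i) (fun i : F => y i)

/-- Powersets are cofinal among finite families of index sets, so this makes a convergent sum of
minors the limit of finite determinants. -/
theorem sum_powerset_minorDet [DecidableEq κ] (M : κ → κ → ℂ) (E : Finset κ) :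
    ∑ F ∈ E.powerset, (-1) ^ F.card * minorDet M F =
      (1 - Matrix.of fun i j : E => M i j).det := by
  classical
  rw [Matrix.det_one_sub_eq_sum_minors]
  symm
  refine Finset.sum_nbij (fun s : Finset E => s.map (Function.Embedding.subtype _)) ?_ ?_ ?_ ?_
  · intro s _
    rw [Finset.mem_powerset]
    intro x hx
    obtain ⟨y, _, rfl⟩ := Finset.mem_map.1 hx
    exact y.2
  · intro s _ t _ h
    exact Finset.map_injective _ h
  · intro F hF
    refine ⟨F.subtype (· ∈ E), by simp, ?_⟩
    exact Finset.subtype_map_of_mem fun x hx => Finset.mem_powerset.1 hF hx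
  · intro s _
    rw [Finset.card_map, minorDet_eq]
    congr 1
    let e := s.equivMap (Function.Embedding.subtype (· ∈ E))
    rw [← Matrix.det_submatrix_equiv_self e]
    congr 1

theorem norm_neg_one_pow_mul (n : ℕ) (z : ℂ) : ‖(-1) ^ n * z‖ = ‖z‖ := by
  simp

/-- `T = ∑ₖ ⟪bₖ, ·⟫ aₖ` with `∑ₖ ‖aₖ‖ ‖bₖ‖ < ∞`. -/
structure IsNuclearExpansion (a b : κ → H) (T : H →L[ℂ] H) : Prop where
  summable : Summable fun k => ‖a k‖ * ‖b k‖
  hasSum : ∀ x : H, HasSum (fun k => inner ℂ (b k) x • a k) (T x)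

/-- The Fredholm determinant `det (I - T)` of `T = ∑ₖ ⟪bₖ, ·⟫ aₖ`, expanded in the minors of the
matrix `(⟪bᵢ, aⱼ⟫)`. -/
noncomputable def nuclearDet (a b : κ → H) : ℂ :=
  ∑' G : Finset κ, (-1) ^ G.card * minorDet (fun i j => inner ℂ (b i) (a j)) G

/-- Hadamard bounds each term by a product over G, and the products of a summable nonnegative family
over all finite sets are summable. -/
theorem summable_nuclearDet {a b : κ → H} (h : Summable fun k => ‖a k‖ * ‖b k‖) :
    Summable fun G : Finset κ => (-1) ^ G.card * minorDet (fun i j => inner ℂ (b i) (a j)) G := by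
  refine (summable_finsetProd_of_summable_nonneg (fun k => by positivity) h).of_norm_bounded
    fun G => ?_
  rw [norm_neg_one_pow_mul]
  refine (norm_minorDet_inner_le b a G).trans_eq ?_
  simp_rw [mul_comm]

theorem tendsto_det_nuclearDet [DecidableEq κ] {a b : κ → H}
    (h : Summable fun k => ‖a k‖ * ‖b k‖) :
    Tendsto (fun S : Finset κ => (1 - Matrix.of fun i j : S => inner ℂ (b i) (a j)).det) atTop
      (𝓝 (nuclearDet a b)) := by
  have := (summable_nuclearDet h).hasSum.comp tendsto_finset_powerset_atTop_atTop
  refine this.congr fun S => ?_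
  exact sum_powerset_minorDet (fun i j => inner ℂ (b i) (a j)) S

variable {ι : Type*}

theorem norm_sum_inner_smul_le {e : ι → H} (he : Orthonormal ℂ e) (E : Finset ι) (x : H) :
    ‖∑ i ∈ E, inner ℂ (e i) x • e i‖ ≤ ‖x‖ := by
  refine le_of_sq_le_sq ?_ (norm_nonneg _)
  have h1 : ‖∑ i ∈ E, inner ℂ (e i) x • e i‖ ^ 2 = ∑ i ∈ E, ‖inner ℂ (e i) x‖ ^ 2 := by
    have h := he.inner_sum (fun i => inner ℂ (e i) x) (fun i => inner ℂ (e i) x) E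
    rw [inner_self_eq_norm_sq_to_K] at h
    refine Complex.ofReal_injective ?_
    push_cast
    refine h.trans (Finset.sum_congr rfl fun i _ => ?_)
    exact Complex.conj_mul' _
  rw [h1]
  exact he.sum_inner_products_le x

/-- Truncating the expansion to a finite S turns the two sides into det(1 - AB) and det(1 - BA) with
A of shape E × S; then S grows. -/
theorem det_compression_eq_nuclearDet [DecidableEq ι] {a b : κ → H} {T : H →L[ℂ] H}
    (h : IsNuclearExpansion a b T) {e : ι → H} (he : Orthonormal ℂ e) (E : Finset ι) :
    (1 - Matrix.of fun i j : E => inner ℂ (e i) (T (e j))).det =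
      nuclearDet (fun k => ∑ i ∈ E, inner ℂ (e i) (a k) • e i) b := by
  classical
  have hs : Summable fun k => ‖∑ i ∈ E, inner ℂ (e i) (a k) • e i‖ * ‖b k‖ :=
    h.summable.of_nonneg_of_le (fun k => by positivity) fun k =>
      mul_le_mul_of_nonneg_right (norm_sum_inner_smul_le he E (a k)) (norm_nonneg _)
  refine tendsto_nhds_unique ?_ (tendsto_det_nuclearDet hs)
  have key : ∀ S : Finset κ,
      (1 - Matrix.of fun k l : S =>
        inner ℂ (b k) (∑ i ∈ E, inner ℂ (e i) (a l) • e i)).det =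
      (1 - Matrix.of fun i j : E =>
        inner ℂ (e i) (∑ k ∈ S, inner ℂ (b k) (e j) • a k)).det := by
    intro S
    let A : Matrix E S ℂ := Matrix.of fun i k => inner ℂ (e i) (a k)
    let B : Matrix S E ℂ := Matrix.of fun k i => inner ℂ (b k) (e i)
    have h1 : (Matrix.of fun k l : S =>
        inner ℂ (b k) (∑ i ∈ E, inner ℂ (e i) (a l) • e i)) = B * A := by
      ext k l
      simp only [Matrix.of_apply, Matrix.mul_apply, A, B, inner_sum, inner_smul_right]
      rw [← Finset.sum_coe_sort E]
      exact Finset.sum_congr rfl fun i _ => mul_comm _ _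
    have h2 : (Matrix.of fun i j : E =>
        inner ℂ (e i) (∑ k ∈ S, inner ℂ (b k) (e j) • a k)) = A * B := by
      ext i j
      simp only [Matrix.of_apply, Matrix.mul_apply, A, B, inner_sum, inner_smul_right]
      rw [← Finset.sum_coe_sort S]
      exact Finset.sum_congr rfl fun i _ => mul_comm _ _
    rw [h1, h2, Matrix.det_one_sub_mul_comm]
  simp_rw [key]
  have hdet : Continuous fun M : Matrix E E ℂ => (1 - M).det :=
    (continuous_const.sub continuous_id).matrix_det
  refine (hdet.tendsto _).comp ?_
  refine tendsto_pi_nhds.2 fun i => tendsto_pi_nhds.2 fun j => ?_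
  exact ((continuous_const.inner continuous_id).tendsto _).comp (h.hasSum (e j))

/-- Dominated convergence as E grows: the projections onto the span of e_i, i ∈ E, converge strongly
to the identity and never increase ‖a_k‖. -/
theorem tendsto_det_compression {a b : κ → H} {T : H →L[ℂ] H}
    (h : IsNuclearExpansion a b T) (e : HilbertBasis ι ℂ H) [DecidableEq ι] :
    Tendsto (fun E : Finset ι => (1 - Matrix.of fun i j : E => inner ℂ (e i) (T (e j))).det) atTop
      (𝓝 (nuclearDet a b)) := by
  classical
  simp_rw [det_compression_eq_nuclearDet h e.orthonormal]
  refine tendsto_tsum_of_dominated_convergence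
    (summable_finsetProd_of_summable_nonneg (fun k => by positivity) h.summable) ?_ ?_
  · intro G
    refine Tendsto.const_mul _ ?_
    simp_rw [minorDet_eq]
    have hdet : Continuous fun M : Matrix G G ℂ => M.det := continuous_id.matrix_det
    refine (hdet.tendsto _).comp ?_
    refine tendsto_pi_nhds.2 fun i => tendsto_pi_nhds.2 fun j => ?_
    refine ((continuous_const.inner continuous_id).tendsto _).comp ?_
    have := e.hasSum_repr (a j)
    simp_rw [e.repr_apply_apply] at this
    exact this
  · refine Eventually.of_forall fun E G => ?_
    rw [norm_neg_one_pow_mul]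
    refine (norm_minorDet_inner_le b _ G).trans ?_
    refine Finset.prod_le_prod (fun k _ => by positivity) fun k _ => ?_
    rw [mul_comm]
    exact mul_le_mul_of_nonneg_right (norm_sum_inner_smul_le e.orthonormal E (a k))
      (norm_nonneg _)

theorem memℓp_inner {a : κ → H} (ha : Summable fun k => ‖a k‖ ^ 2) (v : H) :
    Memℓp (fun k => inner ℂ (a k) v) 2 := by
  refine memℓp_gen ?_
  simp only [ENNReal.toReal_ofNat, Real.rpow_ofNat]
  refine (ha.mul_right (‖v‖ ^ 2)).of_nonneg_of_le (fun k => by positivity) fun k => ?_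
  rw [← mul_pow]
  exact pow_le_pow_left₀ (norm_nonneg _) (norm_inner_le_norm _ _) 2

/-- The square summable sequence `k ↦ ⟪aₖ, v⟫`. -/
noncomputable def coordLp {a : κ → H} (ha : Summable fun k => ‖a k‖ ^ 2) (v : H) :
    lp (fun _ : κ => ℂ) 2 := ⟨fun k => inner ℂ (a k) v, memℓp_inner ha v⟩

theorem norm_coordLp_sq {a : κ → H} (ha : Summable fun k => ‖a k‖ ^ 2) (v : H) :
    HasSum (fun k => ‖inner ℂ (a k) v‖ ^ 2) (‖coordLp ha v‖ ^ 2) := by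
  have := lp.hasSum_norm (p := 2) (by norm_num) (coordLp ha v)
  simp only [ENNReal.toReal_ofNat, Real.rpow_ofNat] at this
  exact this

theorem summable_norm_coordLp_sq {a : κ → H} (ha : Summable fun k => ‖a k‖ ^ 2) {e : ι → H}
    (he : Orthonormal ℂ e) : Summable fun i => ‖coordLp ha (e i)‖ ^ 2 := by
  refine summable_of_sum_le (fun i => by positivity) (c := ∑' k, ‖a k‖ ^ 2) fun E => ?_
  have h := hasSum_sum fun i (_ : i ∈ E) => norm_coordLp_sq ha (e i)
  refine hasSum_le (fun k => ?_) h ha.hasSum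
  simp_rw [norm_inner_symm (a k)]
  exact he.sum_inner_products_le (a k)

theorem exists_balanced_expansion {a b : κ → H} (h : Summable fun k => ‖a k‖ * ‖b k‖) :
    ∃ a' b' : κ → H, (Summable fun k => ‖a' k‖ ^ 2) ∧ (Summable fun k => ‖b' k‖ ^ 2) ∧
      ∀ k x, inner ℂ (b' k) x • a' k = inner ℂ (b k) x • a k := by
  let w : κ → ℝ := fun k => √(‖a k‖ * ‖b k‖)
  have hw : ∀ k, w k ^ 2 = ‖a k‖ * ‖b k‖ := fun k => Real.sq_sqrt (by positivity)
  have hn : ∀ (c : κ → H) k, ‖((w k / ‖c k‖ : ℝ) : ℂ) • c k‖ ^ 2 ≤ ‖a k‖ * ‖b k‖ := by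
    intro c k
    rw [norm_smul, Complex.norm_real, Real.norm_of_nonneg (by positivity), ← hw]
    refine pow_le_pow_left₀ (by positivity) ?_ 2
    -- For c k = 0 the weight is a division by zero, hence 0.
    by_cases hc : ‖c k‖ = 0
    · rw [hc]
      simp only [div_zero, zero_mul, w]
      positivity
    · rw [div_mul_cancel₀ _ hc]
  refine ⟨fun k => ((w k / ‖a k‖ : ℝ) : ℂ) • a k, fun k => ((w k / ‖b k‖ : ℝ) : ℂ) • b k,
    h.of_nonneg_of_le (fun k => by positivity) (hn a),
    h.of_nonneg_of_le (fun k => by positivity) (hn b), fun k x => ?_⟩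
  by_cases hak : a k = 0
  · simp [hak]
  by_cases hbk : b k = 0
  · simp [hbk]
  have h1 : ‖a k‖ ≠ 0 := by simpa using hak
  have h2 : ‖b k‖ ≠ 0 := by simpa using hbk
  rw [inner_smul_left, Complex.conj_ofReal, smul_smul]
  congr 1
  have h3 : (w k / ‖b k‖) * (w k / ‖a k‖) = 1 := by
    rw [div_mul_div_comm, ← sq, hw]
    field_simp
  have h4 : ((w k / ‖b k‖ : ℝ) : ℂ) * ((w k / ‖a k‖ : ℝ) : ℂ) = 1 := by
    rw [← Complex.ofReal_mul, h3, Complex.ofReal_one]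
  linear_combination (inner ℂ (b k) x) * h4

/-- Compressions give a limit along powersets only, so unordered summability needs its own proof.
After balancing, ⟪e_i, T e_j⟫ is an inner product in ℓ² of vectors whose norms are square summable
in the index (Hilbert-Schmidt), and Hadamard applies there. -/
theorem summable_principalMinor {a b : κ → H} {T : H →L[ℂ] H}
    (h : IsNuclearExpansion a b T) (e : HilbertBasis ι ℂ H) :
    Summable fun F : Finset ι => (-1 : ℂ) ^ F.card * principalMinor e T F := by
  obtain ⟨a', b', ha, hb, hab⟩ := exists_balanced_expansion h.summable
  have hT : ∀ i j, inner ℂ (e i) (T (e j)) =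
      inner ℂ (coordLp ha (e i)) (coordLp hb (e j)) := by
    intro i j
    have h1 := (h.hasSum (e j)).mapL (innerSL ℂ (e i))
    refine h1.unique ?_
    convert lp.hasSum_inner (coordLp ha (e i)) (coordLp hb (e j)) using 2 with k
    rw [← hab, innerSL_apply_apply, inner_smul_right]
    simp [coordLp, inner_conj_symm]
  have hs : Summable fun i => ‖coordLp ha (e i)‖ * ‖coordLp hb (e i)‖ := by
    refine ((summable_norm_coordLp_sq ha e.orthonormal).add
      (summable_norm_coordLp_sq hb e.orthonormal)).of_nonneg_of_le (fun i => by positivity)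
      fun i => ?_
    nlinarith [sq_nonneg (‖coordLp ha (e i)‖ - ‖coordLp hb (e i)‖),
      sq_nonneg ‖coordLp ha (e i)‖, sq_nonneg ‖coordLp hb (e i)‖]
  refine (summable_finsetProd_of_summable_nonneg (fun i => by positivity) hs).of_norm_bounded fun F => ?_
  rw [norm_neg_one_pow_mul]
  have : principalMinor e T F =
      minorDet (fun i j => inner ℂ (coordLp ha (e i)) (coordLp hb (e j))) F := by
    simp_rw [← hT]
    rfl
  rw [this]
  exact norm_minorDet_inner_le _ _ F

theorem IsNuclearExpansion.hasSum_principalMinor {a b : κ → H} {T : H →L[ℂ] H}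
    (h : IsNuclearExpansion a b T) (e : HilbertBasis ι ℂ H) :
    HasSum (fun F : Finset ι => (-1 : ℂ) ^ F.card * principalMinor e T F) (nuclearDet a b) := by
  classical
  have hs := (summable_principalMinor h e).hasSum
  have h1 := hs.comp tendsto_finset_powerset_atTop_atTop
  have h2 := tendsto_det_compression h e
  convert hs using 1
  refine tendsto_nhds_unique h2 (h1.congr fun E => ?_)
  exact sum_powerset_minorDet (fun i j => inner ℂ (e i) (T (e j))) E

theorem IsNuclearExpansion.isTraceClass {a b : κ → H} {T : H →L[ℂ] H}
    (h : IsNuclearExpansion a b T) (f : ℕ ≃ κ) : IsTraceClass T :=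
  ⟨a ∘ f, b ∘ f, f.summable_iff.2 h.summable, fun x => f.hasSum_iff.2 (h.hasSum x)⟩

theorem IsNuclearExpansion.hasFredholmDet {a b : κ → H} {T : H →L[ℂ] H}
    (h : IsNuclearExpansion a b T) (f : ℕ ≃ κ) : HasFredholmDet T (nuclearDet a b) :=
  ⟨h.isTraceClass f, fun _ e => h.hasSum_principalMinor e⟩

end NuclearDet

/-! ### Holomorphy, limits and non-vanishing of nuclear determinants -/

section NuclearDetProperties

variable {H : Type*} [NormedAddCommGroup H] [InnerProductSpace ℂ H] {κ : Type*}

theorem norm_term_nuclearDet_le {a b : κ → H} {c : κ → ℝ} (h : ∀ k, ‖a k‖ * ‖b k‖ ≤ c k)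
    (G : Finset κ) :
    ‖(-1 : ℂ) ^ G.card * minorDet (fun i j => inner ℂ (b i) (a j)) G‖ ≤ ∏ k ∈ G, c k := by
  rw [norm_neg_one_pow_mul]
  refine (norm_minorDet_inner_le b a G).trans ?_
  exact Finset.prod_le_prod (fun k _ => by positivity) fun k _ => by
    rw [mul_comm]
    exact h k

theorem differentiableOn_nuclearDet {a b : ℂ → κ → H} {U : Set ℂ} (hU : IsOpen U) {c : κ → ℝ}
    (hc : Summable c) (h : ∀ s ∈ U, ∀ k, ‖a s k‖ * ‖b s k‖ ≤ c k)
    (hd : ∀ i j, DifferentiableOn ℂ (fun s => inner ℂ (b s i) (a s j)) U) :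
    DifferentiableOn ℂ (fun s => nuclearDet (a s) (b s)) U := by
  rcases U.eq_empty_or_nonempty with rfl | ⟨s₀, hs₀⟩
  · exact differentiableOn_empty
  have hc0 : ∀ k, 0 ≤ c k := fun k => le_trans (by positivity) (h s₀ hs₀ k)
  refine Complex.differentiableOn_tsum_of_summable_norm
    (summable_finsetProd_of_summable_nonneg hc0 hc) (fun G => ?_) hU
    (fun G s hs => norm_term_nuclearDet_le (h s hs) G)
  classical
  simp_rw [minorDet_eq, Matrix.det_apply]
  refine DifferentiableOn.const_mul (DifferentiableOn.fun_sum fun p _ => ?_) _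
  refine DifferentiableOn.const_smul ?_ _
  exact DifferentiableOn.fun_finsetProd fun i _ => hd _ _

/-- A nonempty G contributes a factor tending to 0; only the empty minor, equal to 1, survives. -/
theorem tendsto_nuclearDet_one {α : Type*} {l : Filter α} {a b : α → κ → H} {c : κ → ℝ}
    (hc : Summable c) (hc0 : ∀ k, 0 ≤ c k) (h : ∀ᶠ s in l, ∀ k, ‖a s k‖ * ‖b s k‖ ≤ c k)
    (h0 : ∀ k, Tendsto (fun s => ‖a s k‖ * ‖b s k‖) l (𝓝 0)) :
    Tendsto (fun s => nuclearDet (a s) (b s)) l (𝓝 1) := by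
  classical
  have h1 : (1 : ℂ) = ∑' G : Finset κ, if G = ∅ then 1 else 0 := by
    rw [tsum_ite_eq]
  rw [h1]
  refine tendsto_tsum_of_dominated_convergence
    (summable_finsetProd_of_summable_nonneg hc0 hc) (fun G => ?_)
    (h.mono fun s hs G => norm_term_nuclearDet_le hs G)
  rcases G.eq_empty_or_nonempty with rfl | ⟨k, hk⟩
  · simpa [minorDet_eq] using tendsto_const_nhds
  · rw [if_neg (Finset.ne_empty_of_mem hk)]
    refine squeeze_zero_norm (fun s => norm_term_nuclearDet_le (fun _ => le_rfl) G) ?_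
    rw [← Finset.prod_eq_zero hk (f := fun _ => (0 : ℝ)) rfl]
    exact tendsto_finsetProd G fun k _ => h0 k

/-- A bound independent of S, needed for the inverse matrices in
`IsNuclearExpansion.nuclearDet_ne_zero`: expand in minors, apply Hadamard, and use 1 + x ≤ e^x. -/
theorem norm_det_one_add_le (S : Finset κ) {a b : κ → H} {C : ℝ}
    (hs : Summable fun k => ‖a k‖ * ‖b k‖) (hC : 0 ≤ C) [DecidableEq κ] (R : H →L[ℂ] H)
    (hR : ‖R‖ ≤ C) :
    ‖(1 + Matrix.of fun i j : S => inner ℂ (b i) (R (a j))).det‖ ≤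
      Real.exp (C * ∑' k, ‖a k‖ * ‖b k‖) := by
  have h1 : (1 + Matrix.of fun i j : S => inner ℂ (b i) (R (a j))) =
      1 - Matrix.of fun i j : S => inner ℂ (b i) (-R (a j)) := by
    ext i j
    simp
  rw [h1, ← sum_powerset_minorDet (fun i j => inner ℂ (b i) (-R (a j)))]
  have hle : ∀ k, ‖-R (a k)‖ * ‖b k‖ ≤ C * (‖a k‖ * ‖b k‖) := fun k => by
    rw [norm_neg, ← mul_assoc]
    exact mul_le_mul_of_nonneg_right (R.le_of_opNorm_le hR (a k)) (norm_nonneg _)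
  calc _ ≤ ∑ F ∈ S.powerset, ∏ k ∈ F, (C * (‖a k‖ * ‖b k‖)) :=
        norm_sum_le_of_le _ fun F _ => norm_term_nuclearDet_le (a := fun k => -R (a k)) hle F
    _ = ∏ k ∈ S, (1 + C * (‖a k‖ * ‖b k‖)) := (Finset.prod_one_add S).symm
    _ ≤ ∏ k ∈ S, Real.exp (C * (‖a k‖ * ‖b k‖)) :=
        Finset.prod_le_prod (fun k _ => by positivity) fun k _ => by
          linarith [Real.add_one_le_exp (C * (‖a k‖ * ‖b k‖))]
    _ = Real.exp (C * ∑ k ∈ S, ‖a k‖ * ‖b k‖) := by rw [← Real.exp_sum, Finset.mul_sum]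
    _ ≤ _ := Real.exp_le_exp.2 (mul_le_mul_of_nonneg_left
        (hs.sum_le_tsum S fun k _ => by positivity) hC)

/-- Norm convergence, rather than strong convergence, is what keeps the truncations of an invertible
I - T eventually invertible. -/
theorem IsNuclearExpansion.hasSum_rankOne [CompleteSpace H] {a b : κ → H} {T : H →L[ℂ] H}
    (h : IsNuclearExpansion a b T) :
    HasSum (fun k => InnerProductSpace.rankOne ℂ (a k) (b k)) T := by
  have hs : Summable fun k => InnerProductSpace.rankOne ℂ (a k) (b k) :=
    Summable.of_norm (by simpa using h.summable)
  convert hs.hasSum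
  ext x
  refine (h.hasSum x).unique ?_
  have := hs.hasSum.mapL (ContinuousLinearMap.apply ℂ H x)
  simpa using this

/-- The Fredholm determinant of an invertible operator `I - T` does not vanish. -/
theorem IsNuclearExpansion.nuclearDet_ne_zero [CompleteSpace H] {a b : κ → H} {T : H →L[ℂ] H}
    (h : IsNuclearExpansion a b T) (hT : IsUnit (1 - T)) : nuclearDet a b ≠ 0 := by
  classical
  let TS : Finset κ → H →L[ℂ] H := fun S => ∑ k ∈ S, InnerProductSpace.rankOne ℂ (a k) (b k)
  have hTS : Tendsto (fun S => 1 - TS S) atTop (𝓝 (1 - T)) :=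
    h.hasSum_rankOne.const_sub 1
  obtain ⟨u, hu⟩ := hT
  have hinv : Tendsto (fun S => Ring.inverse (1 - TS S)) atTop (𝓝 (Ring.inverse (1 - T))) := by
    have := NormedRing.inverse_continuousAt u
    rw [hu] at this
    exact this.tendsto.comp hTS
  have hunit : ∀ᶠ S in atTop, IsUnit (1 - TS S) := by
    refine hTS.eventually (Units.isOpen.mem_nhds ?_)
    exact ⟨u, hu⟩
  let C := ‖Ring.inverse (1 - T)‖ + 1
  have hC : ∀ᶠ S in atTop, ‖Ring.inverse (1 - TS S)‖ ≤ C :=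
    (hinv.norm.eventually_lt_const (lt_add_one _)).mono fun _ => le_of_lt
  let D := Real.exp (C * ∑' k, ‖a k‖ * ‖b k‖)
  -- With R = (1 - T_S)⁻¹, the finite matrix 1 - (⟪b_i, a_j⟫) has the inverse 1 + (⟪b_i, R a_j⟫),
  -- whose determinant is at most D uniformly in S. The lower bound therefore passes to the limit.
  have hlow : ∀ᶠ S : Finset κ in atTop,
      D⁻¹ ≤ ‖(1 - Matrix.of fun i j : S => inner ℂ (b i) (a j)).det‖ := by
    filter_upwards [hunit, hC] with S hS hSC
    set R := Ring.inverse (1 - TS S)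
    have hRa : ∀ x, TS S (R x) = R x - x := by
      intro x
      have h1 : (1 - TS S) * R = 1 := Ring.mul_inverse_cancel _ hS
      have h2 := congrArg (fun f : H →L[ℂ] H => f x) h1
      simp only [mul_apply_eq_comp, sub_apply,
        one_apply_eq_self] at h2
      rw [sub_eq_iff_eq_add] at h2
      rw [eq_sub_iff_add_eq, add_comm]
      exact h2.symm
    have hmul : (1 - Matrix.of fun i j : S => inner ℂ (b i) (a j)) *
        (1 + Matrix.of fun i j : S => inner ℂ (b i) (R (a j))) = 1 := by
      have hMN : (Matrix.of fun i j : S => inner ℂ (b i) (a j)) *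
          (Matrix.of fun i j : S => inner ℂ (b i) (R (a j))) =
          (Matrix.of fun i j : S => inner ℂ (b i) (R (a j))) -
            Matrix.of fun i j : S => inner ℂ (b i) (a j) := by
        ext i j
        simp only [Matrix.mul_apply, Matrix.of_apply, Matrix.sub_apply]
        rw [← inner_sub_right, ← hRa]
        simp only [TS, sum_apply, InnerProductSpace.rankOne_apply, inner_sum,
          inner_smul_right]
        rw [← Finset.sum_coe_sort S]
        exact Finset.sum_congr rfl fun k _ => mul_comm _ _
      rw [sub_mul, mul_add, mul_add, hMN]
      simp
    have hdet := congrArg (fun M => ‖M.det‖) hmul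
    simp only [Matrix.det_mul, Matrix.det_one, norm_mul, norm_one] at hdet
    have hD := norm_det_one_add_le S h.summable (by positivity) R hSC
    have hD0 : 0 < D := Real.exp_pos _
    rw [inv_le_iff_one_le_mul₀ hD0]
    calc (1 : ℝ) = _ := hdet.symm
      _ ≤ _ := mul_le_mul_of_nonneg_left hD (norm_nonneg _)
  have hlim := ge_of_tendsto (tendsto_det_nuclearDet h.summable).norm hlow
  have hD0 : 0 < D := Real.exp_pos _
  exact norm_pos_iff.1 ((inv_pos.2 hD0).trans_le hlim)

end NuclearDetProperties

/-! ### Determinants of positive contractions and projections -/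

section Positive

open scoped ComplexOrder

variable {H : Type*} [NormedAddCommGroup H] [InnerProductSpace ℂ H]

theorem ContinuousLinearMap.IsPositive.posSemidef_compression {T : H →L[ℂ] H}
    (hT : T.IsPositive) {n : Type*} [Fintype n] (e : n → H) :
    (Matrix.of fun i j => inner ℂ (e i) (T (e j))).PosSemidef := by
  refine Matrix.PosSemidef.of_dotProduct_mulVec_nonneg ?_ fun x => ?_
  · ext i j
    simp only [Matrix.conjTranspose_apply, Matrix.of_apply, RCLike.star_def, inner_conj_symm]
    exact hT.inner_left_eq_inner_right _ _
  · have := hT.inner_nonneg_right (∑ i, x i • e i)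
    convert this using 1
    simp only [map_sum, map_smul, sum_inner, inner_sum, inner_smul_left, inner_smul_right,
      dotProduct, Matrix.mulVec, Matrix.of_apply, Pi.star_apply, RCLike.star_def]
    simp_rw [Finset.mul_sum]
    rw [Finset.sum_comm]
    exact Finset.sum_congr rfl fun i _ => Finset.sum_congr rfl fun j _ => by ring

theorem one_sub_compression {T : H →L[ℂ] H} {n : Type*} [DecidableEq n] {e : n → H}
    (he : Orthonormal ℂ e) :
    (1 - Matrix.of fun i j => inner ℂ (e i) (T (e j))) =
      Matrix.of fun i j => inner ℂ (e i) ((1 - T) (e j)) := by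
  ext i j
  simp [Matrix.one_apply, orthonormal_iff_ite.1 he i j]

theorem HasFredholmDet.tendsto_det_compression {T : H →L[ℂ] H} {d : ℂ} (h : HasFredholmDet T d)
    {w : Set H} (e : HilbertBasis w ℂ H) [DecidableEq w] :
    Tendsto (fun E : Finset w => (1 - Matrix.of fun i j : E => inner ℂ (e i) (T (e j))).det) atTop
      (𝓝 d) := by
  have := (h.2 w e).comp tendsto_finset_powerset_atTop_atTop
  exact this.congr fun E => sum_powerset_minorDet (fun i j => inner ℂ (e i) (T (e j))) E

theorem HasFredholmDet.nonneg [CompleteSpace H] {T : H →L[ℂ] H} {d : ℂ} (h : HasFredholmDet T d)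
    (h1 : (1 - T).IsPositive) : 0 ≤ d := by
  classical
  obtain ⟨w, e, -⟩ := exists_hilbertBasis ℂ H
  refine ge_of_tendsto' (h.tendsto_det_compression e) fun E => ?_
  rw [one_sub_compression (e := fun i : E => e i) (e.orthonormal.comp _ Subtype.val_injective)]
  exact (h1.posSemidef_compression _).det_nonneg

/-- Extend an orthonormal basis of the range of P; each added vector is orthogonal to the range,
hence killed by P. -/
theorem IsStarProjection.exists_adapted_hilbertBasis [CompleteSpace H] {P : H →L[ℂ] H}
    (hP : IsStarProjection P) :
    ∃ (w : Set H) (e : HilbertBasis w ℂ H), ∀ i, P (e i) = e i ∨ P (e i) = 0 := by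
  -- The range of P, written as a kernel so that it is visibly closed.
  let U : Submodule ℂ H := (1 - P).ker
  have hU : ∀ x, x ∈ U ↔ P x = x := fun x => by
    simp only [U, LinearMap.mem_ker, ContinuousLinearMap.coe_coe, sub_apply, one_apply_eq_self,
      sub_eq_zero]
    exact eq_comm
  have : CompleteSpace U := (1 - P).isClosed_ker.completeSpace_coe
  obtain ⟨v, b, hb⟩ := exists_hilbertBasis ℂ U
  have hs : Orthonormal ℂ ((↑) : (Subtype.val '' v : Set H) → H) := by
    have h1 : Orthonormal ℂ (fun i : v => ((b i : U) : H)) :=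
      b.orthonormal.comp_linearIsometry U.subtypeₗᵢ
    have h2 := h1.toSubtypeRange
    have h3 : Set.range (fun i : v => ((b i : U) : H)) = Subtype.val '' v := by
      rw [hb]
      ext x
      simp
    rw [h3] at h2
    exact h2
  obtain ⟨w, e, hvw, he⟩ := hs.exists_hilbertBasis_extension
  refine ⟨w, e, fun i => ?_⟩
  by_cases hi : e i ∈ (Subtype.val '' v : Set H)
  · obtain ⟨x, -, hx⟩ := hi
    exact Or.inl (hx ▸ (hU _).1 x.2)
  · right
    have hPP : ∀ x, P (P x) = P x := fun x =>
      congrArg (fun f : H →L[ℂ] H => f x) hP.isIdempotentElem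
    have hadj : ∀ x y, inner ℂ (P x) y = inner ℂ x (P y) := fun x y => by
      have := ContinuousLinearMap.adjoint_inner_left P y x
      rwa [hP.isSelfAdjoint.adjoint_eq] at this
    let y : U := ⟨P (e i), (hU _).2 (hPP _)⟩
    have hy : y = 0 := by
      have hz : ∀ z, b.repr y z = 0 := fun z => by
        have hbz : ((b z : U) : H) ∈ (Subtype.val '' v : Set H) :=
          ⟨b z, by simp [hb], rfl⟩
        have hne : (⟨(b z : U), hvw hbz⟩ : w) ≠ i := by
          rintro rfl
          exact hi (by simpa [he] using hbz)
        rw [b.repr_apply_apply, Submodule.coe_inner]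
        change inner ℂ ((b z : U) : H) (P (e i)) = 0
        rw [← hadj, (hU _).1 (b z).2]
        have := e.orthonormal.2 hne
        rwa [he] at this ⊢
      refine (b.hasSum_repr y).unique ?_
      simp only [hz, zero_smul]
      exact hasSum_zero
    exact congrArg Subtype.val hy

/-- In an adapted basis, passing from T to PT replaces the rows of 1 - T outside the range of P by
identity rows, leaving a principal minor, which can only be larger. -/
theorem HasFredholmDet.re_le_comp_projection [CompleteSpace H] {T P : H →L[ℂ] H} {d d' : ℂ}
    (h : HasFredholmDet T d) (h' : HasFredholmDet (P ∘L T) d') (h0 : T.IsPositive)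
    (h1 : (1 - T).IsPositive) (hP : IsStarProjection P) : d.re ≤ d'.re := by
  classical
  obtain ⟨w, e, he⟩ := hP.exists_adapted_hilbertBasis
  have hadj : ∀ x y, inner ℂ (P x) y = inner ℂ x (P y) := fun x y => by
    have := ContinuousLinearMap.adjoint_inner_left P y x
    rwa [hP.isSelfAdjoint.adjoint_eq] at this
  refine le_of_tendsto_of_tendsto'
    ((Complex.continuous_re.tendsto _).comp (h.tendsto_det_compression e))
    ((Complex.continuous_re.tendsto _).comp (h'.tendsto_det_compression e)) fun E => ?_
  simp only [Function.comp_apply, ContinuousLinearMap.comp_apply]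
  let M : Matrix E E ℂ := 1 - Matrix.of fun i j : E => inner ℂ (e i) (T (e j))
  have hon : Orthonormal ℂ fun i : E => e i := e.orthonormal.comp _ Subtype.val_injective
  have hM : M.PosSemidef := by
    simp only [M]
    rw [one_sub_compression hon]
    exact h1.posSemidef_compression _
  have hM1 : (1 - M).PosSemidef := by
    simp only [M, sub_sub_cancel]
    exact h0.posSemidef_compression _
  let s : Finset E := Finset.univ.filter fun i => P (e i) = e i
  have hpw : (1 - Matrix.of fun i j : E => inner ℂ (e i) (P (T (e j)))) =
      Matrix.of (s.piecewise M.row (Matrix.row 1)) := by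
    ext i j
    simp only [Finset.piecewise, Matrix.sub_apply, Matrix.of_apply]
    rw [← hadj]
    rcases he i with hi | hi
    · rw [if_pos (by simp [s, hi]), hi]
      rfl
    · have hne : P (e i) ≠ e i := by
        rw [hi]
        exact (e.orthonormal.ne_zero i).symm
      rw [if_neg (by simp [s, hne]), hi, inner_zero_left, sub_zero]
      rfl
  rw [hpw, Matrix.det_piecewise_one_eq_submatrix_det]
  convert! hM.det_re_le_submatrix hM1 (· ∈ s)

end Positive

/-! ## Exponential functions and cut-offs in `L²((0, ∞); ℂⁿ)` -/

section Exponentials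

open scoped ENNReal

variable {n : Type} [Fintype n]

/-- The decaying exponential `x ↦ e^{-λ x}`, with complex values. -/
noncomputable def decay (lam x : ℝ) : ℂ := (Real.exp (-(lam * x)) : ℝ)

theorem norm_decay (lam x : ℝ) : ‖decay lam x‖ = Real.exp (-(lam * x)) := by
  rw [decay, Complex.norm_real, Real.norm_of_nonneg (Real.exp_nonneg _)]

theorem continuous_decay (lam : ℝ) : Continuous (decay lam) := by
  unfold decay
  fun_prop

theorem decay_mul (lam lam' x : ℝ) : decay lam x * decay lam' x = decay (lam + lam') x := by
  rw [decay, decay, decay, ← Complex.ofReal_mul, ← Real.exp_add]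
  congr 3
  ring

theorem integral_decay {lam : ℝ} (h : 0 < lam) (t : ℝ) :
    ∫ x in Ioi t, decay lam x = decay lam t / lam := by
  simp only [decay]
  rw [integral_complex_ofReal]
  have := integral_exp_mul_Ioi (neg_lt_zero.2 h) t
  simp only [neg_mul] at this
  rw [this, neg_div_neg_eq, Complex.ofReal_div]

theorem memLp_decay {lam : ℝ} (h : 0 < lam) :
    MemLp (decay lam) 2 (volume.restrict (Ioi (0 : ℝ))) := by
  rw [memLp_two_iff_integrable_sq_norm (continuous_decay lam).aestronglyMeasurable]
  have := integrableOn_exp_mul_Ioi (a := -(2 * lam)) (by linarith) 0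
  refine this.congr_fun (fun x _ => ?_) measurableSet_Ioi
  simp only [norm_decay]
  rw [← Real.exp_nat_mul]
  congr 1
  push_cast
  ring

theorem memLp_decay_smul {lam : ℝ} (h : 0 < lam) (v : EuclideanSpace ℂ n) :
    MemLp (fun x => decay lam x • v) 2 (volume.restrict (Ioi (0 : ℝ))) :=
  (memLp_top_const v).smul (memLp_decay h)

theorem integrable_decay_smul {lam : ℝ} (h : 0 < lam) (f : L2HalfLine n) :
    Integrable (fun x => decay lam x • f x) (volume.restrict (Ioi (0 : ℝ))) :=
  memLp_one_iff_integrable.1 ((Lp.memLp f).smul (memLp_decay h))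

/-- The embedding `v ↦ (x ↦ e^{-λ x} v)`. -/
noncomputable def expEmb (n : Type) [Fintype n] {lam : ℝ} (h : 0 < lam) :
    EuclideanSpace ℂ n →L[ℂ] L2HalfLine n :=
  LinearMap.toContinuousLinearMap
    { toFun := fun v => (memLp_decay_smul h v).toLp _
      map_add' := fun v w => by
        rw [← MemLp.toLp_add]
        congr 1
        ext1 x
        simp [smul_add]
      map_smul' := fun c v => by
        rw [RingHom.id_apply, ← MemLp.toLp_const_smul]
        congr 1
        ext1 x
        exact smul_comm _ _ _ }

theorem coeFn_expEmb {lam : ℝ} (h : 0 < lam) (v : EuclideanSpace ℂ n) :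
    expEmb n h v =ᵐ[volume.restrict (Ioi (0 : ℝ))] fun x => decay lam x • v :=
  MemLp.coeFn_toLp (memLp_decay_smul h v)

theorem adjoint_expEmb_apply {lam : ℝ} (h : 0 < lam) (f : L2HalfLine n) :
    (expEmb n h).adjoint f = ∫ x in Ioi (0 : ℝ), decay lam x • f x := by
  refine ext_inner_left ℂ fun v => ?_
  rw [ContinuousLinearMap.adjoint_inner_right, L2.inner_def,
    ← integral_inner (integrable_decay_smul h f)]
  refine integral_congr_ae ?_
  filter_upwards [coeFn_expEmb h v] with x hx
  rw [hx, inner_smul_left, inner_smul_right, decay, Complex.conj_ofReal]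

theorem coeFn_cutoffProj (t : ℝ) (f : L2HalfLine n) :
    cutoffProj n t f =ᵐ[volume.restrict (Ioi (0 : ℝ))] (Ioi t).indicator f :=
  coeFn_cutoffFun t f

theorem cutoffProj_zero : cutoffProj n 0 = 1 := by
  ext1 f
  apply Lp.ext
  filter_upwards [coeFn_cutoffProj 0 f, ae_restrict_mem measurableSet_Ioi] with x hx h0
  rw [hx, indicator_of_mem h0]
  rfl

theorem cutoffProj_comp {t t' : ℝ} (h : t ≤ t') :
    cutoffProj n t' ∘L cutoffProj n t = cutoffProj n t' := by
  ext1 f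
  apply Lp.ext
  filter_upwards [coeFn_cutoffProj t' (cutoffProj n t f), coeFn_cutoffProj t f,
    coeFn_cutoffProj t' f] with x h1 h2 h3
  rw [ContinuousLinearMap.comp_apply, h1, h3]
  by_cases hx : x ∈ Ioi t'
  · rw [indicator_of_mem hx, indicator_of_mem hx, h2,
      indicator_of_mem (Ioi_subset_Ioi h hx)]
  · rw [indicator_of_notMem hx, indicator_of_notMem hx]

theorem adjoint_cutoffProj (t : ℝ) : (cutoffProj n t).adjoint = cutoffProj n t := by
  symm
  rw [ContinuousLinearMap.eq_adjoint_iff]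
  intro f g
  rw [L2.inner_def, L2.inner_def]
  refine integral_congr_ae ?_
  filter_upwards [coeFn_cutoffProj t f, coeFn_cutoffProj t g] with x h1 h2
  rw [h1, h2]
  by_cases hx : x ∈ Ioi t
  · rw [indicator_of_mem hx, indicator_of_mem hx]
  · rw [indicator_of_notMem hx, indicator_of_notMem hx, inner_zero_left, inner_zero_right]

theorem isStarProjection_cutoffProj (t : ℝ) : IsStarProjection (cutoffProj n t) :=
  ⟨cutoffProj_comp le_rfl, adjoint_cutoffProj t⟩

/-- The one explicit integral of the proof. The factor e^{-(λ+λ')t} splits between the two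
exponentials, which is why a cut-off acts as a shift of symbols. -/
theorem adjoint_expEmb_cutoffProj_expEmb {lam lam' : ℝ} (h : 0 < lam) (h' : 0 < lam') {t : ℝ}
    (ht : 0 ≤ t) (v : EuclideanSpace ℂ n) :
    (expEmb n h).adjoint (cutoffProj n t (expEmb n h' v)) =
      (decay (lam + lam') t / ((lam + lam' : ℝ) : ℂ)) • v := by
  rw [adjoint_expEmb_apply]
  have h1 : ∫ x in Ioi (0 : ℝ), decay lam x • (cutoffProj n t (expEmb n h' v)) x =
      ∫ x in Ioi (0 : ℝ), (Ioi t).indicator (fun x => decay (lam + lam') x • v) x := by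
    refine integral_congr_ae ?_
    filter_upwards [coeFn_cutoffProj t (expEmb n h' v), coeFn_expEmb h' v] with x h1 h2
    rw [h1]
    by_cases hx : x ∈ Ioi t
    · rw [indicator_of_mem hx, indicator_of_mem hx, h2, smul_smul, decay_mul]
    · rw [indicator_of_notMem hx, indicator_of_notMem hx, smul_zero]
  rw [h1, setIntegral_indicator measurableSet_Ioi, Ioi_inter_Ioi, sup_of_le_right ht,
    integral_smul_const, integral_decay (by linarith)]

theorem adjoint_expEmb_expEmb {lam lam' : ℝ} (h : 0 < lam) (h' : 0 < lam')
    (v : EuclideanSpace ℂ n) :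
    (expEmb n h).adjoint (expEmb n h' v) = (1 / ((lam + lam' : ℝ) : ℂ)) • v := by
  have := adjoint_expEmb_cutoffProj_expEmb h h' le_rfl v
  rw [cutoffProj_zero] at this
  simpa [decay] using this

theorem norm_expEmb_le {lam : ℝ} (h : 1 / 2 < lam) (h0 : 0 < lam) : ‖expEmb n h0‖ ≤ 1 := by
  refine ContinuousLinearMap.opNorm_le_bound _ zero_le_one fun v => ?_
  rw [one_mul]
  refine le_of_sq_le_sq ?_ (norm_nonneg _)
  have h1 := inner_self_eq_norm_sq_to_K (𝕜 := ℂ) (expEmb n h0 v)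
  rw [← ContinuousLinearMap.adjoint_inner_right, adjoint_expEmb_expEmb, inner_smul_right,
    inner_self_eq_norm_sq_to_K] at h1
  have h2 : ‖expEmb n h0 v‖ ^ 2 = 1 / (lam + lam) * ‖v‖ ^ 2 := by
    refine Complex.ofReal_injective ?_
    push_cast at h1 ⊢
    exact h1.symm
  rw [h2]
  refine mul_le_of_le_one_left (by positivity) ?_
  rw [div_le_one (by linarith)]
  linarith

end Exponentials

/-! ## Hankel operators with exponential series as symbols -/

section HankelSeries

open scoped ENNReal

variable {n : Type} [Fintype n] {lam : ℕ → ℝ}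

/-- The embedding `v ↦ (x ↦ e^{-λₗ x} v)`. -/
noncomputable def expMode (n : Type) [Fintype n] (hlam : ∀ l, 1 / 2 < lam l) (l : ℕ) :
    EuclideanSpace ℂ n →L[ℂ] L2HalfLine n :=
  expEmb n (one_half_pos.trans (hlam l))

theorem norm_expMode_le (hlam : ∀ l, 1 / 2 < lam l) (l : ℕ) : ‖expMode n hlam l‖ ≤ 1 :=
  norm_expEmb_le (hlam l) _

theorem norm_expMode_apply_le (hlam : ∀ l, 1 / 2 < lam l) (l : ℕ) (v : EuclideanSpace ℂ n) :
    ‖expMode n hlam l v‖ ≤ ‖v‖ := by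
  simpa using (expMode n hlam l).le_of_opNorm_le (norm_expMode_le hlam l) v

theorem norm_adjoint_expMode_apply_le (hlam : ∀ l, 1 / 2 < lam l) (l : ℕ) (f : L2HalfLine n) :
    ‖(expMode n hlam l).adjoint f‖ ≤ ‖f‖ := by
  have : ‖(expMode n hlam l).adjoint‖ ≤ 1 := by
    rw [LinearIsometryEquiv.norm_map]
    exact norm_expMode_le hlam l
  simpa using (expMode n hlam l).adjoint.le_of_opNorm_le this f

theorem norm_cexp_neg_mul_le_one {c : ℝ} (hc : 0 ≤ c) {z : ℂ} (hz : 0 ≤ z.re) :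
    ‖Complex.exp (-(c * z))‖ ≤ 1 := by
  rw [Complex.norm_exp, Real.exp_le_one_iff]
  simpa using mul_nonneg hc hz

theorem lam_nonneg (hlam : ∀ l, 1 / 2 < lam l) (l : ℕ) : 0 ≤ lam l :=
  (one_half_pos.trans (hlam l)).le

theorem two_mul_re_nonneg {s : ℂ} (hs : 0 ≤ s.re) : 0 ≤ (2 * s).re := by
  simpa using hs

/-- The summand `e^{-2 s λₗ} e^{-λₗ (x + y)} Xₗ` of a Hankel operator. -/
noncomputable def hankelTerm (hlam : ∀ l, 1 / 2 < lam l)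
    (X : ℕ → EuclideanSpace ℂ n →L[ℂ] EuclideanSpace ℂ n) (s : ℂ) (l : ℕ) :
    L2HalfLine n →L[ℂ] L2HalfLine n :=
  Complex.exp (-(lam l * (2 * s))) • (expMode n hlam l ∘L X l ∘L (expMode n hlam l).adjoint)

/-- The Hankel operator with symbol `∑ₗ e^{-λₗ (x + 2 s)} Xₗ`. -/
noncomputable def hankelSeries (hlam : ∀ l, 1 / 2 < lam l)
    (X : ℕ → EuclideanSpace ℂ n →L[ℂ] EuclideanSpace ℂ n) (s : ℂ) :
    L2HalfLine n →L[ℂ] L2HalfLine n :=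
  ∑' l, hankelTerm hlam X s l

variable (hlam : ∀ l, 1 / 2 < lam l) {X : ℕ → EuclideanSpace ℂ n →L[ℂ] EuclideanSpace ℂ n}

theorem hankelTerm_apply (s : ℂ) (l : ℕ) (f : L2HalfLine n) :
    hankelTerm hlam X s l f =
      Complex.exp (-(lam l * (2 * s))) • expMode n hlam l (X l ((expMode n hlam l).adjoint f)) :=
  rfl

theorem norm_hankelTerm_le {s : ℂ} (hs : 0 ≤ s.re) (l : ℕ) : ‖hankelTerm hlam X s l‖ ≤ ‖X l‖ := by
  refine ContinuousLinearMap.opNorm_le_bound _ (norm_nonneg _) fun f => ?_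
  rw [hankelTerm_apply, norm_smul]
  refine (mul_le_of_le_one_left (norm_nonneg _)
    (norm_cexp_neg_mul_le_one (lam_nonneg hlam l) (two_mul_re_nonneg hs))).trans ?_
  refine (norm_expMode_apply_le hlam l _).trans ((X l).le_opNorm_of_le ?_)
  exact norm_adjoint_expMode_apply_le hlam l f

theorem hasSum_hankelSeries (hX : Summable fun l => ‖X l‖) {s : ℂ} (hs : 0 ≤ s.re) :
    HasSum (hankelTerm hlam X s) (hankelSeries hlam X s) :=
  (hX.of_norm_bounded fun l => norm_hankelTerm_le hlam hs l).hasSum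

theorem hasSum_hankelSeries_apply (hX : Summable fun l => ‖X l‖) {s : ℂ} (hs : 0 ≤ s.re)
    (f : L2HalfLine n) :
    HasSum (fun l => Complex.exp (-(lam l * (2 * s))) •
      expMode n hlam l (X l ((expMode n hlam l).adjoint f))) (hankelSeries hlam X s f) :=
  (hasSum_hankelSeries hlam hX hs).mapL (ContinuousLinearMap.apply ℂ (L2HalfLine n) f)

theorem norm_hankelSeries_le (hX : Summable fun l => ‖X l‖) {s : ℂ} (hs : 0 ≤ s.re) :
    ‖hankelSeries hlam X s‖ ≤ ∑' l, ‖X l‖ :=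
  tsum_of_norm_bounded hX.hasSum fun l => norm_hankelTerm_le hlam hs l

theorem differentiableOn_hankelSeries (hX : Summable fun l => ‖X l‖) :
    DifferentiableOn ℂ (hankelSeries hlam X) {s | 0 < s.re} := by
  refine Complex.differentiableOn_tsum_of_summable_norm hX (fun l => ?_)
    (isOpen_lt continuous_const Complex.continuous_re)
    fun l s hs => norm_hankelTerm_le hlam (le_of_lt hs) l
  unfold hankelTerm
  fun_prop

/-- `e^{-y/2} ‖f y‖` is integrable. -/
theorem integrable_exp_mul_norm (f : L2HalfLine n) :
    Integrable (fun y => Real.exp (-(1 / 2 * y)) * ‖f y‖) (volume.restrict (Ioi (0 : ℝ))) := by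
  refine (integrable_decay_smul one_half_pos f).norm.congr (Eventually.of_forall fun y => ?_)
  simp only [norm_smul, norm_decay]

/-- An absolutely convergent series in L² also converges almost everywhere, which allows comparison
with the pointwise integral. -/
theorem ae_hasSum_hankelSeries (hX : Summable fun l => ‖X l‖) {s : ℂ} (hs : 0 ≤ s.re)
    (f : L2HalfLine n) :
    ∀ᵐ x : ℝ ∂(volume.restrict (Ioi (0 : ℝ))), HasSum (fun l =>
      Complex.exp (-(lam l * (x + 2 * s))) • X l ((expMode n hlam l).adjoint f))
      (hankelSeries hlam X s f x) := by
  let g : ℕ → L2HalfLine n := fun l => Complex.exp (-(lam l * (2 * s))) •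
      expMode n hlam l (X l ((expMode n hlam l).adjoint f))
  have hg : HasSum g (hankelSeries hlam X s f) := hasSum_hankelSeries_apply hlam hX hs f
  have hfin : ∑' l, ‖g l‖ₑ ≠ ∞ := by
    have hle : ∀ l, ‖g l‖ ≤ ‖X l‖ * ‖f‖ := fun l =>
      (hankelTerm hlam X s l).le_of_opNorm_le (norm_hankelTerm_le hlam hs l) f
    have hsum : Summable fun l => ‖g l‖ := (hX.mul_right ‖f‖).of_nonneg_of_le
      (fun _ => norm_nonneg _) hle
    simp_rw [← ofReal_norm]
    rw [← ENNReal.ofReal_tsum_of_nonneg (fun _ => norm_nonneg _) hsum]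
    exact ENNReal.ofReal_ne_top
  have h1 := Lp.hasSum_coeFn_tsum hfin
  rw [hg.tsum_eq] at h1
  have h2 : ∀ᵐ x : ℝ ∂(volume.restrict (Ioi (0 : ℝ))), ∀ l, g l x =
      Complex.exp (-(lam l * (x + 2 * s))) • X l ((expMode n hlam l).adjoint f) := by
    refine ae_all_iff.2 fun l => ?_
    filter_upwards [Lp.coeFn_smul (Complex.exp (-(lam l * (2 * s))))
      (expMode n hlam l (X l ((expMode n hlam l).adjoint f))),
      coeFn_expEmb (one_half_pos.trans (hlam l)) (X l ((expMode n hlam l).adjoint f))]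
      with x hx1 hx2
    simp only [g]
    rw [hx1, Pi.smul_apply]
    refine (congrArg _ hx2).trans ?_
    rw [smul_smul, decay, Complex.ofReal_exp,
      ← Complex.exp_add]
    congr 2
    push_cast
    ring
  filter_upwards [h1, h2] with x hx1 hx2
  simp_rw [← hx2]
  exact hx1

theorem norm_cexp_smul_apply_le (hlam : ∀ l, 1 / 2 < lam l) {s : ℂ} (hs : 0 ≤ s.re) {x y : ℝ} (hx : 0 ≤ x) (hy : 0 ≤ y)
    (l : ℕ) (v : EuclideanSpace ℂ n) :
    ‖Complex.exp (-(lam l * ((x + y : ℝ) + 2 * s))) • X l v‖ ≤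
      ‖X l‖ * (Real.exp (-(1 / 2 * y)) * ‖v‖) := by
  have hl := hlam l
  rw [norm_smul, Complex.norm_exp]
  have h1 : Real.exp (-(lam l * ((x + y : ℝ) + 2 * s)) : ℂ).re ≤ Real.exp (-(1 / 2 * y)) := by
    refine Real.exp_le_exp.2 ?_
    simp only [Complex.neg_re, Complex.mul_re, Complex.ofReal_re, Complex.add_re,
      Complex.ofReal_im, zero_mul, sub_zero, Complex.re_ofNat, Complex.im_ofNat]
    nlinarith [mul_nonneg (lam_nonneg hlam l) hs, mul_nonneg (lam_nonneg hlam l) hx,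
      mul_nonneg (sub_nonneg.2 hl.le) hy]
  calc _ ≤ Real.exp (-(1 / 2 * y)) * (‖X l‖ * ‖v‖) :=
        mul_le_mul h1 ((X l).le_opNorm v) (norm_nonneg _) (Real.exp_nonneg _)
    _ = _ := by ring

/-- The operator `hankelSeries` is the Hankel operator whose symbol is the exponential series. -/
theorem isHankelOp_hankelSeries [DecidableEq n] (hX : Summable fun l => ‖X l‖) {s : ℂ}
    (hs : 0 ≤ s.re) {φ : ℝ → Matrix n n ℂ}
    (hφ : ∀ x : ℝ, 0 ≤ x →
      HasSum (fun l => Complex.exp (-(lam l * (x + 2 * s))) • X l) (matCLM (φ x))) :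
    IsHankelOp φ (hankelSeries hlam X s) := by
  intro f
  filter_upwards [ae_hasSum_hankelSeries hlam hX hs f, ae_restrict_mem measurableSet_Ioi]
    with x hx hx0
  have hx0' : 0 ≤ x := le_of_lt hx0
  let F : ℕ → ℝ → EuclideanSpace ℂ n := fun l y =>
    Complex.exp (-(lam l * ((x + y : ℝ) + 2 * s))) • X l (f y)
  have hF : ∀ l y, F l y = Complex.exp (-(lam l * (x + 2 * s))) • X l (decay (lam l) y • f y) := by
    intro l y
    simp only [F, map_smul]
    rw [smul_smul, decay, Complex.ofReal_exp, ← Complex.exp_add]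
    congr 2
    push_cast
    ring
  have hFle : ∀ l y, 0 < y → ‖F l y‖ ≤ ‖X l‖ * (Real.exp (-(1 / 2 * y)) * ‖f y‖) := fun l y hy =>
    norm_cexp_smul_apply_le hlam hs hx0' hy.le l (f y)
  have hFint : ∀ l, Integrable (F l) (volume.restrict (Ioi (0 : ℝ))) := by
    intro l
    have := ((X l).integrable_comp (integrable_decay_smul (one_half_pos.trans (hlam l)) f)).smul
      (Complex.exp (-(lam l * (x + 2 * s))))
    exact this.congr (Eventually.of_forall fun y => (hF l y).symm)
  have hFsum : ∀ y, 0 < y → HasSum (fun l => F l y) (matCLM (φ (x + y)) (f y)) := fun y hy =>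
    (hφ (x + y) (add_nonneg hx0' hy.le)).mapL (ContinuousLinearMap.apply ℂ _ (f y))
  have hG := integrable_exp_mul_norm f
  have hnorm : Summable fun l => ∫ y in Ioi (0 : ℝ), ‖F l y‖ := by
    refine (hX.mul_right (∫ y in Ioi (0 : ℝ), Real.exp (-(1 / 2 * y)) * ‖f y‖)).of_nonneg_of_le
      (fun l => integral_nonneg fun y => norm_nonneg _) fun l => ?_
    rw [← integral_const_mul]
    exact setIntegral_mono_on (hFint l).norm (hG.const_mul _) measurableSet_Ioi
      fun y hy => hFle l y hy
  -- No measurability of φ is assumed; it comes from the partial sums.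
  have hmeas : AEStronglyMeasurable (fun y => matCLM (φ (x + y)) (f y))
      (volume.restrict (Ioi (0 : ℝ))) := by
    refine aestronglyMeasurable_of_tendsto_ae atTop
      (f := fun N y => ∑ l ∈ Finset.range N, F l y) (fun N => ?_) ?_
    · exact (integrable_finsetSum _ fun l _ => hFint l).aestronglyMeasurable
    · filter_upwards [ae_restrict_mem measurableSet_Ioi] with y hy
      exact (hFsum y hy).tendsto_sum_nat
  constructor
  · refine (hG.const_mul (∑' l, ‖X l‖)).mono' hmeas ?_
    filter_upwards [ae_restrict_mem measurableSet_Ioi] with y hy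
    rw [← (hFsum y hy).tsum_eq]
    exact tsum_of_norm_bounded (hX.hasSum.mul_right _) fun l => hFle l y hy
  · have h1 := hasSum_integral_of_summable_integral_norm hFint hnorm
    have h2 : ∫ y in Ioi (0 : ℝ), ∑' l, F l y =
        ∫ y in Ioi (0 : ℝ), matCLM (φ (x + y)) (f y) :=
      setIntegral_congr_fun measurableSet_Ioi fun y hy => (hFsum y hy).tsum_eq
    rw [← h2]
    have h3 : ∀ l, ∫ y in Ioi (0 : ℝ), F l y =
        Complex.exp (-(lam l * (x + 2 * s))) • X l ((expMode n hlam l).adjoint f) := fun l => by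
      rw [funext (hF l), integral_smul, (X l).integral_comp_comm
        (integrable_decay_smul (one_half_pos.trans (hlam l)) f),
        expMode, adjoint_expEmb_apply]
    simp_rw [h3] at h1
    exact hx.unique h1

end HankelSeries

/-! ## Determinants of products of Hankel operators -/

section HankelDet

variable {n : Type} [Fintype n] [DecidableEq n] {lam : ℕ → ℝ} (hlam : ∀ l, 1 / 2 < lam l)
  {X : ℕ → EuclideanSpace ℂ n →L[ℂ] EuclideanSpace ℂ n}

/-- The left factors in the nuclear expansion of a Hankel operator. -/
noncomputable def hankelLeft (X : ℕ → EuclideanSpace ℂ n →L[ℂ] EuclideanSpace ℂ n) (s : ℂ)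
    (k : ℕ × n) : L2HalfLine n :=
  Complex.exp (-(lam k.1 * (2 * s))) • expMode n hlam k.1 (X k.1 (EuclideanSpace.single k.2 1))

/-- The right factors in the nuclear expansion of the product of a Hankel operator and `A`. -/
noncomputable def hankelRight (A : L2HalfLine n →L[ℂ] L2HalfLine n) (k : ℕ × n) : L2HalfLine n :=
  A.adjoint (expMode n hlam k.1 (EuclideanSpace.single k.2 1))

theorem norm_hankelLeft_le_exp (s : ℂ) (k : ℕ × n) :
    ‖hankelLeft hlam X s k‖ ≤ Real.exp (-(lam k.1 * (2 * s.re))) * ‖X k.1‖ := by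
  rw [hankelLeft, norm_smul, Complex.norm_exp]
  have h1 : (-(lam k.1 * (2 * s)) : ℂ).re = -(lam k.1 * (2 * s.re)) := by simp
  rw [h1]
  refine mul_le_mul_of_nonneg_left ?_ (Real.exp_nonneg _)
  refine (norm_expMode_apply_le hlam _ _).trans ?_
  simpa using (X k.1).le_opNorm (EuclideanSpace.single k.2 1)

theorem norm_hankelLeft_le {s : ℂ} (hs : 0 ≤ s.re) (k : ℕ × n) :
    ‖hankelLeft hlam X s k‖ ≤ ‖X k.1‖ := by
  refine (norm_hankelLeft_le_exp hlam s k).trans (mul_le_of_le_one_left (norm_nonneg _) ?_)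
  rw [Real.exp_le_one_iff]
  have := lam_nonneg hlam k.1
  nlinarith [mul_nonneg this hs]

theorem norm_hankelRight_le (A : L2HalfLine n →L[ℂ] L2HalfLine n) (k : ℕ × n) :
    ‖hankelRight hlam A k‖ ≤ ‖A‖ := by
  have h1 := A.adjoint.le_opNorm_of_le (norm_expMode_apply_le hlam k.1
    (EuclideanSpace.single k.2 (1 : ℂ)))
  simpa [hankelRight] using h1

omit [DecidableEq n] in
theorem summable_norm_prod (hX : Summable fun l => ‖X l‖) (C : ℝ) :
    Summable fun k : ℕ × n => ‖X k.1‖ * C := by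
  refine Summable.mul_right C ?_
  exact (summable_prod_of_nonneg fun _ => norm_nonneg _).2
    ⟨fun l => Summable.of_finite, by simpa using hX.mul_left _⟩

/-- Expanding E_l†(A f) in the standard basis splits each summand into rank one pieces. The factors
Q and A allow for cut-offs on either side. -/
theorem isNuclearExpansion_hankelSeries_comp (hX : Summable fun l => ‖X l‖) {s : ℂ}
    (hs : 0 ≤ s.re) (Q A : L2HalfLine n →L[ℂ] L2HalfLine n) :
    IsNuclearExpansion (fun k => Q (hankelLeft hlam X s k)) (hankelRight hlam A)
      (Q ∘L hankelSeries hlam X s ∘L A) := by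
  have hsum : Summable fun k => ‖Q (hankelLeft hlam X s k)‖ * ‖hankelRight hlam A k‖ := by
    refine (summable_norm_prod (n := n) hX (‖Q‖ * ‖A‖)).of_nonneg_of_le
      (fun k => by positivity) fun k => ?_
    calc _ ≤ (‖Q‖ * ‖X k.1‖) * ‖A‖ :=
          mul_le_mul (Q.le_opNorm_of_le (norm_hankelLeft_le hlam hs k))
            (norm_hankelRight_le hlam A k) (norm_nonneg _) (by positivity)
      _ = _ := by ring
  refine ⟨hsum, fun f => ?_⟩
  have hs2 : Summable fun k : ℕ × n =>
      inner ℂ (hankelRight hlam A k) f • Q (hankelLeft hlam X s k) := by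
    refine (hsum.mul_right ‖f‖).of_norm_bounded fun k => ?_
    rw [norm_smul]
    calc _ ≤ (‖hankelRight hlam A k‖ * ‖f‖) * ‖Q (hankelLeft hlam X s k)‖ :=
          mul_le_mul_of_nonneg_right (norm_inner_le_norm _ _) (norm_nonneg _)
      _ = _ := by ring
  have h1 := (hasSum_hankelSeries_apply hlam hX hs (A f)).mapL Q
  convert hs2.hasSum using 1
  refine HasSum.unique h1 ?_
  refine hs2.hasSum.prod_fiberwise fun l => ?_
  convert hasSum_fintype _ using 1
  have h2 : ∀ v : EuclideanSpace ℂ n, v = ∑ p, v p • EuclideanSpace.single p (1 : ℂ) := by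
    intro v
    ext p
    simp [Finset.sum_apply, Pi.single_apply]
  have h3 : ∀ p, inner ℂ (hankelRight hlam A (l, p)) f =
      ((expMode n hlam l).adjoint (A f)) p := by
    intro p
    rw [hankelRight, ContinuousLinearMap.adjoint_inner_left,
      ← ContinuousLinearMap.adjoint_inner_right, EuclideanSpace.inner_single_left]
    simp
  simp_rw [h3]
  conv_lhs => rw [h2 ((expMode n hlam l).adjoint (A f))]
  simp only [map_sum, map_smul, hankelLeft, Finset.smul_sum]
  exact Finset.sum_congr rfl fun p _ => smul_comm _ _ _

/-- The right factors contain an adjoint and so depend antiholomorphically on s; moving A across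
makes the matrix entries holomorphic. -/
theorem inner_hankelRight (A : L2HalfLine n →L[ℂ] L2HalfLine n) (k : ℕ × n) (f : L2HalfLine n) :
    inner ℂ (hankelRight hlam A k) f =
      inner ℂ (expMode n hlam k.1 (EuclideanSpace.single k.2 1)) (A f) :=
  ContinuousLinearMap.adjoint_inner_left _ _ _

/-- The determinant of `I - Γ_s B Γ_s`. -/
noncomputable def hankelTau (X : ℕ → EuclideanSpace ℂ n →L[ℂ] EuclideanSpace ℂ n)
    (B : L2HalfLine n →L[ℂ] L2HalfLine n) (s : ℂ) : ℂ :=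
  nuclearDet (hankelLeft hlam X s) (hankelRight hlam (B ∘L hankelSeries hlam X s))

omit [DecidableEq n] in
theorem exists_nat_equiv [Nonempty n] : Nonempty (ℕ ≃ ℕ × n) :=
  nonempty_equiv_of_countable

theorem hasFredholmDet_hankelTau [Nonempty n] (hX : Summable fun l => ‖X l‖)
    (B : L2HalfLine n →L[ℂ] L2HalfLine n) {s : ℂ} (hs : 0 ≤ s.re) :
    HasFredholmDet (hankelSeries hlam X s ∘L B ∘L hankelSeries hlam X s)
      (hankelTau hlam X B s) := by
  obtain ⟨f⟩ := exists_nat_equiv (n := n)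
  exact (isNuclearExpansion_hankelSeries_comp hlam hX hs 1 _).hasFredholmDet f

omit [DecidableEq n] in
/-- Cutting off an exponential at `t` and applying a Hankel operator shifts its symbol. -/
theorem hankelSeries_cutoffProj_expMode (hX : Summable fun l => ‖X l‖) {t : ℝ} (ht : 0 ≤ t)
    (l : ℕ) (v : EuclideanSpace ℂ n) :
    hankelSeries hlam X 0 (cutoffProj n t (expMode n hlam l v)) =
      Complex.exp (-(lam l * (2 * (t / 2 : ℝ)))) •
        hankelSeries hlam X (t / 2 : ℝ) (expMode n hlam l v) := by
  have ht2 : 0 ≤ ((t / 2 : ℝ) : ℂ).re := by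
    rw [Complex.ofReal_re]
    positivity
  have h1 := hasSum_hankelSeries_apply (X := X) hlam hX (s := 0) (by simp)
    (cutoffProj n t (expMode n hlam l v))
  have h2 := (hasSum_hankelSeries_apply hlam hX ht2 (expMode n hlam l v)).const_smul
    (Complex.exp (-(lam l * (2 * (t / 2 : ℝ)))))
  refine h1.unique (h2.congr_fun fun l' => ?_)
  simp only [expMode, adjoint_expEmb_expEmb, adjoint_expEmb_cutoffProj_expEmb _ _ ht, map_smul,
    smul_smul, mul_zero, neg_zero, Complex.exp_zero]
  congr 1
  rw [decay, Complex.ofReal_exp, ← mul_assoc, ← Complex.exp_add, one_mul, mul_one_div]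
  congr 2
  push_cast
  ring

theorem hankelSeries_cutoffProj_hankelLeft (hX : Summable fun l => ‖X l‖) {t : ℝ} (ht : 0 ≤ t)
    (k : ℕ × n) :
    hankelSeries hlam X 0 (cutoffProj n t (hankelLeft hlam X 0 k)) =
      hankelSeries hlam X (t / 2 : ℝ) (hankelLeft hlam X (t / 2 : ℝ) k) := by
  simp only [hankelLeft, mul_zero, neg_zero, Complex.exp_zero, one_smul, map_smul]
  exact hankelSeries_cutoffProj_expMode hlam hX ht _ _

/-- If `P Q` is the cut-off at `t`, then `det (I - Q Γ₀ B Γ₀ P) = det (I - Γ_s B Γ_s)` with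
`s = t / 2`. -/
theorem hasFredholmDet_cutoff [Nonempty n] (hX : Summable fun l => ‖X l‖)
    (B : L2HalfLine n →L[ℂ] L2HalfLine n) {t : ℝ} (ht : 0 ≤ t)
    (Q P : L2HalfLine n →L[ℂ] L2HalfLine n) (hPQ : P ∘L Q = cutoffProj n t) :
    HasFredholmDet (Q ∘L (hankelSeries hlam X 0 ∘L B ∘L hankelSeries hlam X 0) ∘L P)
      (hankelTau hlam X B (t / 2 : ℝ)) := by
  obtain ⟨f⟩ := exists_nat_equiv (n := n)
  have h := (isNuclearExpansion_hankelSeries_comp hlam hX (s := 0) (by simp) Q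
    (B ∘L hankelSeries hlam X 0 ∘L P)).hasFredholmDet f
  refine (?_ : hankelTau hlam X B (t / 2 : ℝ) = _) ▸ h
  -- The matrices agree entry by entry: Q sits in the left factors and P in the right ones, so the
  -- entries see only the product P Q.
  unfold hankelTau nuclearDet
  congr! 5 with G i
  funext j
  rw [inner_hankelRight, inner_hankelRight]
  have hPQ' : ∀ x, P (Q x) = cutoffProj n t x := fun x =>
    congrArg (fun T : L2HalfLine n →L[ℂ] L2HalfLine n => T x) hPQ
  simp only [ContinuousLinearMap.comp_apply]
  rw [hPQ', hankelSeries_cutoffProj_hankelLeft hlam hX ht]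

theorem norm_hankelFactors_le (hX : Summable fun l => ‖X l‖)
    (B : L2HalfLine n →L[ℂ] L2HalfLine n) {s : ℂ} (hs : 0 ≤ s.re) (k : ℕ × n) :
    ‖hankelLeft hlam X s k‖ * ‖hankelRight hlam (B ∘L hankelSeries hlam X s) k‖ ≤
      ‖hankelLeft hlam X s k‖ * (‖B‖ * ∑' l, ‖X l‖) := by
  refine mul_le_mul_of_nonneg_left ((norm_hankelRight_le hlam _ k).trans ?_) (norm_nonneg _)
  refine (B.opNorm_comp_le _).trans (mul_le_mul_of_nonneg_left ?_ (norm_nonneg _))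
  exact norm_hankelSeries_le hlam hX hs

theorem norm_hankelFactors_le' (hX : Summable fun l => ‖X l‖)
    (B : L2HalfLine n →L[ℂ] L2HalfLine n) {s : ℂ} (hs : 0 ≤ s.re) (k : ℕ × n) :
    ‖hankelLeft hlam X s k‖ * ‖hankelRight hlam (B ∘L hankelSeries hlam X s) k‖ ≤
      ‖X k.1‖ * (‖B‖ * ∑' l, ‖X l‖) :=
  (norm_hankelFactors_le hlam hX B hs k).trans
    (mul_le_mul_of_nonneg_right (norm_hankelLeft_le hlam hs k)
      (mul_nonneg (norm_nonneg _) (tsum_nonneg fun _ => norm_nonneg _)))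

theorem differentiableOn_hankelTau (hX : Summable fun l => ‖X l‖)
    (B : L2HalfLine n →L[ℂ] L2HalfLine n) :
    DifferentiableOn ℂ (hankelTau hlam X B) {s | 0 < s.re} := by
  refine differentiableOn_nuclearDet (isOpen_lt continuous_const Complex.continuous_re)
    (summable_norm_prod hX _) (fun s hs k => norm_hankelFactors_le' hlam hX B (le_of_lt hs) k)
    fun i j => ?_
  simp_rw [inner_hankelRight, ContinuousLinearMap.comp_apply]
  have h1 : DifferentiableOn ℂ (fun s => hankelLeft hlam X s j) {s | 0 < s.re} := by
    unfold hankelLeft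
    fun_prop
  have h2 := (differentiableOn_hankelSeries hlam hX).clm_apply h1
  exact ((innerSL ℂ (expMode n hlam i.1 (EuclideanSpace.single i.2 1))) ∘L B
    ).differentiable.comp_differentiableOn h2

theorem tendsto_hankelTau (hX : Summable fun l => ‖X l‖) (B : L2HalfLine n →L[ℂ] L2HalfLine n)
    {α : Type*} {L : Filter α} {u : α → ℂ} (hu : Tendsto (fun x => (u x).re) L atTop) :
    Tendsto (fun x => hankelTau hlam X B (u x)) L (𝓝 1) := by
  have hC : 0 ≤ ‖B‖ * ∑' l, ‖X l‖ :=
    mul_nonneg (norm_nonneg _) (tsum_nonneg fun _ => norm_nonneg _)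
  have hre : ∀ᶠ x in L, 0 ≤ (u x).re := hu.eventually_ge_atTop 0
  refine tendsto_nuclearDet_one (summable_norm_prod hX _) (fun k => mul_nonneg (norm_nonneg _) hC)
    (hre.mono fun x hx k => norm_hankelFactors_le' hlam hX B hx k) fun k => ?_
  have h1 : Tendsto (fun x => Real.exp (-(lam k.1 * (2 * (u x).re))) * ‖X k.1‖ *
      (‖B‖ * ∑' l, ‖X l‖)) L (𝓝 0) := by
    have hpos : 0 < lam k.1 := one_half_pos.trans (hlam k.1)
    have h2 : Tendsto (fun x => lam k.1 * (2 * (u x).re)) L atTop :=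
      (hu.const_mul_atTop two_pos).const_mul_atTop hpos
    have h3 := Real.tendsto_exp_neg_atTop_nhds_zero.comp h2
    simpa using (h3.mul_const ‖X k.1‖).mul_const (‖B‖ * ∑' l, ‖X l‖)
  refine squeeze_zero' (Eventually.of_forall fun x => by positivity) ?_ h1
  filter_upwards [hre] with x hx
  exact (norm_hankelFactors_le hlam hX B hx k).trans
    (mul_le_mul_of_nonneg_right (norm_hankelLeft_le_exp hlam _ k) hC)

theorem hankelTau_ne_zero (hX : Summable fun l => ‖X l‖)
    (B : L2HalfLine n →L[ℂ] L2HalfLine n) {s : ℂ} (hs : 0 ≤ s.re)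
    (h : ‖B‖ * ‖hankelSeries hlam X s‖ ^ 2 < 1) : hankelTau hlam X B s ≠ 0 := by
  refine (isNuclearExpansion_hankelSeries_comp hlam hX hs 1 _).nuclearDet_ne_zero ?_
  refine isUnit_one_sub_of_norm_lt_one (lt_of_le_of_lt ?_ h)
  change ‖hankelSeries hlam X s ∘L B ∘L hankelSeries hlam X s‖ ≤ _
  calc _ ≤ ‖hankelSeries hlam X s‖ * (‖B‖ * ‖hankelSeries hlam X s‖) :=
        (ContinuousLinearMap.opNorm_comp_le _ _).trans
          (mul_le_mul_of_nonneg_left (ContinuousLinearMap.opNorm_comp_le _ _) (norm_nonneg _))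
    _ = _ := by ring

end HankelDet

/-! ## The Hilbert-Schmidt bound for Hankel operators -/

section HilbertSchmidt

open scoped ENNReal

/-- In the quadrant, the points with x + y = u are parametrised by 0 < x < u, an interval of length
u. -/
theorem lintegral_lintegral_comp_add {h : ℝ → ℝ≥0∞} (hh : Measurable h) :
    ∫⁻ x in Ioi (0 : ℝ), ∫⁻ y in Ioi (0 : ℝ), h (x + y) =
      ∫⁻ u in Ioi (0 : ℝ), ENNReal.ofReal u * h u := by
  have h1 : ∀ x : ℝ, ∫⁻ y in Ioi (0 : ℝ), h (x + y) = ∫⁻ u, (Ioi x).indicator h u := by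
    intro x
    rw [← lintegral_indicator measurableSet_Ioi, ← lintegral_add_left_eq_self ((Ioi x).indicator h) x]
    congr 1
    ext y
    simp [indicator]
  simp_rw [h1]
  rw [lintegral_lintegral_swap]
  · rw [← lintegral_indicator measurableSet_Ioi]
    congr 1
    ext u
    have h2 : ∀ x : ℝ, (Ioi x).indicator h u = (Iio u).indicator (fun _ => h u) x := fun x => by
      simp [indicator]
    simp_rw [h2]
    rw [lintegral_indicator measurableSet_Iio, Measure.restrict_restrict measurableSet_Iio,
      setLIntegral_const, Iio_inter_Ioi, Real.volume_Ioo, sub_zero, mul_comm]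
    by_cases hu : 0 < u
    · simp [hu]
    · simp [hu, ENNReal.ofReal_of_nonpos (not_lt.1 hu)]
  · have : (Function.uncurry fun x u : ℝ => (Ioi x).indicator h u) =
        {p : ℝ × ℝ | p.1 < p.2}.indicator fun p => h p.2 := by
      ext p
      simp [Function.uncurry, indicator]
    rw [this]
    exact ((hh.comp measurable_snd).indicator
      (measurableSet_lt measurable_fst measurable_snd)).aemeasurable

variable {n : Type} [Fintype n]

theorem enorm_sq_eq_lintegral (f : L2HalfLine n) :
    ‖f‖ₑ ^ 2 = ∫⁻ x in Ioi (0 : ℝ), ‖f x‖ₑ ^ 2 := by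
  rw [Lp.enorm_def, eLpNorm_eq_lintegral_rpow_enorm_toReal (by norm_num) (by norm_num)]
  simp only [ENNReal.toReal_ofNat, ENNReal.rpow_ofNat]
  rw [← ENNReal.rpow_natCast, ← ENNReal.rpow_mul]
  norm_num

theorem sq_lintegral_mul_le {α : Type*} [MeasurableSpace α] (μ : Measure α) {f g : α → ℝ≥0∞}
    (hf : AEMeasurable f μ) (hg : AEMeasurable g μ) :
    (∫⁻ x, f x * g x ∂μ) ^ 2 ≤ (∫⁻ x, f x ^ 2 ∂μ) * ∫⁻ x, g x ^ 2 ∂μ := by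
  have h := ENNReal.lintegral_mul_le_Lp_mul_Lq μ Real.HolderConjugate.two_two hf hg
  have h2 := pow_le_pow_left₀ (zero_le) h 2
  refine h2.trans_eq ?_
  rw [mul_pow]
  simp only [ENNReal.rpow_ofNat]
  rw [← ENNReal.rpow_natCast, ← ENNReal.rpow_mul, ← ENNReal.rpow_natCast, ← ENNReal.rpow_mul]
  norm_num

/-- Cauchy-Schwarz in y for each x, then integration in x. The continuous majorant g makes
measurability of φ unnecessary. -/
theorem IsHankelOp.norm_sq_le [DecidableEq n] {φ : ℝ → Matrix n n ℂ}
    {G : L2HalfLine n →L[ℂ] L2HalfLine n} (hG : IsHankelOp φ G) {g : ℝ → ℝ} (hg : Continuous g)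
    (hg0 : ∀ x, 0 ≤ g x) (hφ : ∀ x, 0 < x → ‖matCLM (φ x)‖ ≤ g x)
    (hint : IntegrableOn (fun x => x * g x ^ 2) (Ioi 0)) :
    ‖G‖ ^ 2 ≤ ∫ x in Ioi (0 : ℝ), x * g x ^ 2 := by
  set I := ∫ x in Ioi (0 : ℝ), x * g x ^ 2 with hI
  have hI0 : 0 ≤ I := setIntegral_nonneg measurableSet_Ioi fun x hx =>
    mul_nonneg (le_of_lt hx) (sq_nonneg _)
  let h : ℝ → ℝ≥0∞ := fun u => ENNReal.ofReal (g u)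
  have hh : Measurable h := hg.measurable.ennreal_ofReal
  have hIE : ∫⁻ x in Ioi (0 : ℝ), ∫⁻ y in Ioi (0 : ℝ), h (x + y) ^ 2 = ENNReal.ofReal I := by
    rw [lintegral_lintegral_comp_add (h := fun u => h u ^ 2) (hh.pow_const 2), hI,
      ofReal_integral_eq_lintegral_ofReal hint ((ae_restrict_iff' measurableSet_Ioi).2
        (Eventually.of_forall fun x hx => mul_nonneg (le_of_lt hx) (sq_nonneg _)))]
    refine setLIntegral_congr_fun measurableSet_Ioi fun u hu => ?_
    simp only [h]
    rw [ENNReal.ofReal_mul (le_of_lt hu), ENNReal.ofReal_pow (hg0 u)]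
  have key : ∀ f : L2HalfLine n, ‖G f‖ₑ ^ 2 ≤ ENNReal.ofReal I * ‖f‖ₑ ^ 2 := by
    intro f
    rw [enorm_sq_eq_lintegral, ← hIE, ← lintegral_mul_const' _ _ (by simp)]
    refine lintegral_mono_ae ?_
    filter_upwards [hG f, ae_restrict_mem measurableSet_Ioi] with x hx hx0
    have h1 : ‖G f x‖ₑ ≤ ∫⁻ y in Ioi (0 : ℝ), h (x + y) * ‖f y‖ₑ := by
      rw [hx.2]
      refine (enorm_integral_le_lintegral_enorm _).trans ?_
      refine setLIntegral_mono' measurableSet_Ioi fun y hy => ?_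
      have hxy : 0 < x + y := add_pos hx0 hy
      simp only [h]
      rw [← ofReal_norm, ← ofReal_norm, ← ENNReal.ofReal_mul (hg0 _)]
      exact ENNReal.ofReal_le_ofReal ((matCLM (φ (x + y))).le_of_opNorm_le (hφ _ hxy) _)
    refine (pow_le_pow_left₀ (zero_le) h1 2).trans ?_
    rw [enorm_sq_eq_lintegral f]
    exact sq_lintegral_mul_le _ (hh.comp (measurable_const_add x)).aemeasurable
      (Lp.aestronglyMeasurable f).enorm
  have hle : ‖G‖ ≤ √I := by
    refine ContinuousLinearMap.opNorm_le_bound _ (Real.sqrt_nonneg _) fun f => ?_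
    refine le_of_sq_le_sq ?_ (by positivity)
    rw [mul_pow, Real.sq_sqrt hI0]
    have := key f
    rw [← ofReal_norm, ← ofReal_norm, ← ENNReal.ofReal_pow (norm_nonneg _),
      ← ENNReal.ofReal_pow (norm_nonneg _), ← ENNReal.ofReal_mul hI0] at this
    exact (ENNReal.ofReal_le_ofReal_iff (by positivity)).1 this
  calc ‖G‖ ^ 2 ≤ √I ^ 2 := pow_le_pow_left₀ (norm_nonneg _) hle 2
    _ = I := Real.sq_sqrt hI0

theorem integrableOn_mul_sq_of_le_exp {g : ℝ → ℝ} (hg : Continuous g) (hg0 : ∀ x, 0 ≤ g x)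
    {C : ℝ} (hle : ∀ x, 0 < x → g x ≤ C * Real.exp (-(1 / 2 * x))) :
    IntegrableOn (fun x => x * g x ^ 2) (Ioi 0) := by
  have h1 := (integrableOn_exp_mul_Ioi (a := -(1 / 2)) (by norm_num) 0).const_mul (2 * C ^ 2)
  refine h1.mono' (by fun_prop) ?_
  filter_upwards [ae_restrict_mem measurableSet_Ioi] with x hx
  have hx0 : 0 < x := hx
  rw [Real.norm_of_nonneg (by positivity)]
  have h2 : g x ^ 2 ≤ C ^ 2 * Real.exp (-(1 / 2) * x) ^ 2 := by
    rw [← mul_pow, neg_mul]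
    exact pow_le_pow_left₀ (hg0 x) (hle x hx0) 2
  -- From 1 + x/2 ≤ e^{x/2}.
  have h3 : x * Real.exp (-(1 / 2) * x) ≤ 2 := by
    have h4 := Real.add_one_le_exp (1 / 2 * x)
    have h5 : Real.exp (1 / 2 * x) * Real.exp (-(1 / 2) * x) = 1 := by
      rw [← Real.exp_add]
      ring_nf
      exact Real.exp_zero
    nlinarith [Real.exp_pos (-(1 / 2) * x)]
  calc x * g x ^ 2 ≤ x * (C ^ 2 * Real.exp (-(1 / 2) * x) ^ 2) :=
        mul_le_mul_of_nonneg_left h2 hx0.le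
    _ = (x * Real.exp (-(1 / 2) * x)) * (C ^ 2 * Real.exp (-(1 / 2) * x)) := by ring
    _ ≤ 2 * (C ^ 2 * Real.exp (-(1 / 2) * x)) :=
        mul_le_mul_of_nonneg_right h3 (by positivity)
    _ = _ := by ring

/-- Enlarge the weight x to x + a; translation then gives the right-hand integrand over the smaller
half-line (a, ∞). -/
theorem integral_mul_shift_le {g : ℝ → ℝ} {a : ℝ} (ha : 0 ≤ a)
    (hint : IntegrableOn (fun x => x * g x ^ 2) (Ioi 0))
    (hint' : IntegrableOn (fun x => x * g (x + a) ^ 2) (Ioi 0)) :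
    ∫ x in Ioi (0 : ℝ), x * g (x + a) ^ 2 ≤ ∫ x in Ioi (0 : ℝ), x * g x ^ 2 := by
  have hsub : Ioi a ⊆ Ioi (0 : ℝ) := Ioi_subset_Ioi ha
  have hnn : 0 ≤ᵐ[volume.restrict (Ioi (0 : ℝ))] fun x => x * g x ^ 2 :=
    (ae_restrict_iff' measurableSet_Ioi).2
      (Eventually.of_forall fun x hx => mul_nonneg (le_of_lt hx) (sq_nonneg _))
  have hmp := measurePreserving_add_right volume a
  have hemb := (MeasurableEquiv.addRight a).measurableEmbedding
  have hpre : (fun x : ℝ => x + a) ⁻¹' Ioi a = Ioi 0 := by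
    ext x
    simp
  have h1 : ∫ x in Ioi (0 : ℝ), (x + a) * g (x + a) ^ 2 = ∫ x in Ioi a, x * g x ^ 2 := by
    rw [← hmp.setIntegral_preimage_emb hemb (fun x => x * g x ^ 2) (Ioi a), hpre]
  have h2 : IntegrableOn (fun x => (x + a) * g (x + a) ^ 2) (Ioi 0) := by
    have := (hmp.integrableOn_comp_preimage hemb (f := fun x => x * g x ^ 2) (s := Ioi a)).2
      (hint.mono_set hsub)
    rwa [hpre] at this
  calc _ ≤ ∫ x in Ioi (0 : ℝ), (x + a) * g (x + a) ^ 2 :=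
        setIntegral_mono_on hint' h2 measurableSet_Ioi fun x _ =>
          mul_le_mul_of_nonneg_right (by linarith) (sq_nonneg _)
    _ = ∫ x in Ioi a, x * g x ^ 2 := h1
    _ ≤ _ := setIntegral_mono_set hint hnn hsub.eventuallyLE

end HilbertSchmidt

/-! ## The scattering symbol -/

section Scattering

variable {m : ℕ}

/-- The block matrix `[0, v; v†, 0]`. -/
noncomputable def offDiagMat (v : EuclideanSpace ℂ (Fin m)) :
    Matrix (Fin m ⊕ Unit) (Fin m ⊕ Unit) ℂ :=
  Matrix.fromBlocks 0 (Matrix.of fun i _ => v i) (Matrix.of fun _ j => star (v j)) 0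

/-- The map `v ↦ [0, v; v†, 0]`, as a real linear map into operators. -/
noncomputable def offDiagLin (m : ℕ) : EuclideanSpace ℂ (Fin m) →ₗ[ℝ]
    (EuclideanSpace ℂ (Fin m ⊕ Unit) →L[ℂ] EuclideanSpace ℂ (Fin m ⊕ Unit)) where
  toFun v := matCLM (offDiagMat v)
  map_add' v w := by
    rw [matCLM, matCLM, matCLM, ← map_add]
    congr 1
    ext (i | i) (j | j) <;> simp [offDiagMat]
  map_smul' c v := by
    have : offDiagMat (c • v) = (c : ℂ) • offDiagMat v := by
      ext (i | i) (j | j) <;> simp [offDiagMat]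
    rw [this, matCLM, matCLM, map_smul]
    rfl

theorem summable_norm_offDiag {χ : ℕ → EuclideanSpace ℂ (Fin m)} (hχ : Summable fun l => ‖χ l‖) :
    Summable fun l => ‖matCLM (offDiagMat (χ l))‖ := by
  let L := (offDiagLin m).toContinuousLinearMap
  exact (hχ.mul_left ‖L‖).of_nonneg_of_le (fun _ => norm_nonneg _) fun l => L.le_opNorm (χ l)

/-- The decay rates `κ + l + 1/2`. -/
noncomputable def decayRate (κ : ℝ) (l : ℕ) : ℝ := κ + l + 1 / 2

theorem half_lt_decayRate {κ : ℝ} (hκ : 0 < κ) (l : ℕ) : 1 / 2 < decayRate κ l := by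
  unfold decayRate
  have : (0 : ℝ) ≤ l := Nat.cast_nonneg l
  linarith

theorem hasSum_scatteringFun {κ : ℝ} (hκ : 0 < κ) {χ : ℕ → EuclideanSpace ℂ (Fin m)}
    (hχ : Summable fun l => ‖χ l‖) {z : ℂ} (hz : 0 ≤ z.re) :
    HasSum (fun l => Complex.exp (-(decayRate κ l * z)) • χ l) (scatteringFun κ χ z) := by
  have h1 : ∀ l : ℕ, Complex.exp (-((κ : ℂ) + (l : ℂ) + 1 / 2) * z) =
      Complex.exp (-(decayRate κ l * z)) := fun l => by
    congr 1
    simp only [decayRate]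
    push_cast
    ring
  unfold scatteringFun
  simp_rw [h1]
  refine (hχ.of_norm_bounded fun l => ?_).hasSum
  rw [norm_smul]
  exact mul_le_of_le_one_left (norm_nonneg _)
    (norm_cexp_neg_mul_le_one (one_half_pos.trans (half_lt_decayRate hκ l)).le hz)

theorem hasSum_symbolMat {κ : ℝ} (hκ : 0 < κ) {χ : ℕ → EuclideanSpace ℂ (Fin m)}
    (hχ : Summable fun l => ‖χ l‖) {z : ℂ} (hz : 0 ≤ z.re) :
    HasSum (fun l => Complex.exp (-(decayRate κ l * z)) • matCLM (offDiagMat (χ l)))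
      (matCLM (symbolMat κ χ z)) := by
  have h1 : ∀ {w : ℂ}, 0 ≤ w.re → ∀ i,
      HasSum (fun l => Complex.exp (-(decayRate κ l * w)) * χ l i) (scatteringFun κ χ w i) :=
    fun hw i => (hasSum_scatteringFun hκ hχ hw).mapL (EuclideanSpace.proj (𝕜 := ℂ) i)
  have hmat : HasSum (fun l => Complex.exp (-(decayRate κ l * z)) • offDiagMat (χ l))
      (symbolMat κ χ z) := by
    refine Pi.hasSum.2 fun i => Pi.hasSum.2 fun j => ?_
    rcases i with i | i <;> rcases j with j | j
    · simp [offDiagMat, symbolMat]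
    · simpa [offDiagMat, symbolMat] using h1 hz i
    -- Conjugating both the argument and the value restores the exponential e^{-λz}, so this block
    -- is holomorphic in z too.
    · have h2 := (h1 (w := star z) (by simpa using hz) j).star
      convert h2 using 1
      · ext l
        simp only [offDiagMat, Matrix.smul_apply, Matrix.fromBlocks_apply₂₁, Matrix.of_apply,
          smul_eq_mul, star_mul', RCLike.star_def, ← Complex.exp_conj]
        simp
      · rfl
    · simp [offDiagMat, symbolMat]
  have hcont : Continuous (Matrix.toEuclideanCLM (n := Fin m ⊕ Unit) (𝕜 := ℂ)) :=
    (Matrix.toEuclideanCLM (n := Fin m ⊕ Unit) (𝕜 := ℂ)).toAlgEquiv.toLinearMap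
      |>.continuous_of_finiteDimensional
  have h3 := hmat.map (Matrix.toEuclideanCLM (n := Fin m ⊕ Unit) (𝕜 := ℂ)) hcont
  refine h3.congr_fun fun l => ?_
  simp [matCLM]

/-- Conjugating the argument and taking the adjoint exchanges the off-diagonal blocks, which are
each other's images. So both factors of K_s are one and the same Hankel operator. -/
theorem shiftedSymbolStar_eq (κ : ℝ) (χ : ℕ → EuclideanSpace ℂ (Fin m)) (s : ℂ) :
    shiftedSymbolStar κ χ s = shiftedSymbol κ χ s := by
  ext x i j
  have h : (x : ℂ) + 2 * star s = star ((x : ℂ) + 2 * s) := by simp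
  rw [shiftedSymbolStar, shiftedSymbol, h, Matrix.conjTranspose_apply]
  rcases i with i | i <;> rcases j with j | j <;> simp [symbolMat]

variable {κ : ℝ} (hκ : 0 < κ) {χ : ℕ → EuclideanSpace ℂ (Fin m)}

/-- The Hankel operator with symbol `Ψ_{(s)}`. -/
noncomputable def scatteringOp (hκ : 0 < κ) (χ : ℕ → EuclideanSpace ℂ (Fin m)) (s : ℂ) :
    L2HalfLine (Fin m ⊕ Unit) →L[ℂ] L2HalfLine (Fin m ⊕ Unit) :=
  hankelSeries (half_lt_decayRate hκ) (fun l => matCLM (offDiagMat (χ l))) s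

theorem isHankelOp_scatteringOp (hχ : Summable fun l => ‖χ l‖) {s : ℂ}
    (hs : 0 ≤ s.re) :
    IsHankelOp (shiftedSymbol κ χ s) (scatteringOp hκ χ s) := by
  refine isHankelOp_hankelSeries _ (summable_norm_offDiag hχ) hs fun x hx => ?_
  exact hasSum_symbolMat hκ hχ (by simpa using add_nonneg hx (two_mul_re_nonneg hs))

theorem hankelOp_shiftedSymbol (hχ : Summable fun l => ‖χ l‖) {s : ℂ}
    (hs : 0 ≤ s.re) :
    hankelOp (shiftedSymbol κ χ s) = scatteringOp hκ χ s :=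
  (isHankelOp_scatteringOp hκ hχ hs).hankelOp_eq

theorem kernelOp_eq (hχ : Summable fun l => ‖χ l‖)
    (σ : Matrix (Fin m ⊕ Unit) (Fin m ⊕ Unit) ℂ) {s : ℂ} (hs : 0 ≤ s.re) :
    kernelOp κ χ σ s = scatteringOp hκ χ s ∘L constMulOp σ ∘L scatteringOp hκ χ s := by
  rw [kernelOp, shiftedSymbolStar_eq, hankelOp_shiftedSymbol hκ hχ hs]

end Scattering

/-! ### Integral bounds for the scattering symbol -/

section ScatteringNorm

variable {m : ℕ} {κ : ℝ} (hκ : 0 < κ) {χ : ℕ → EuclideanSpace ℂ (Fin m)}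

/-- The operator norm of `Ψ (x + w)`, extended to a continuous function of `x` on the real line. -/
noncomputable def symbolNorm (κ : ℝ) (χ : ℕ → EuclideanSpace ℂ (Fin m)) (w : ℂ) (x : ℝ) : ℝ :=
  ‖matCLM (symbolMat κ χ ((max x 0 : ℝ) + w))‖

theorem symbolNorm_of_nonneg (w : ℂ) {x : ℝ} (hx : 0 ≤ x) :
    symbolNorm κ χ w x = ‖matCLM (symbolMat κ χ (x + w))‖ := by
  rw [symbolNorm, max_eq_left hx]

theorem re_max_add_nonneg {w : ℂ} (hw : 0 ≤ w.re) (x : ℝ) : 0 ≤ (((max x 0 : ℝ) : ℂ) + w).re := by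
  rw [Complex.add_re, Complex.ofReal_re]
  exact add_nonneg (le_max_right _ _) hw

theorem continuous_symbolNorm (hκ : 0 < κ) (hχ : Summable fun l => ‖χ l‖) {w : ℂ}
    (hw : 0 ≤ w.re) : Continuous (symbolNorm κ χ w) := by
  unfold symbolNorm
  simp_rw [fun x => (hasSum_symbolMat hκ hχ (re_max_add_nonneg hw x)).tsum_eq.symm]
  refine (continuous_tsum (fun l => ?_) (summable_norm_offDiag hχ) fun l x => ?_).norm
  · fun_prop
  · rw [norm_smul]
    exact mul_le_of_le_one_left (norm_nonneg _) (norm_cexp_neg_mul_le_one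
      (one_half_pos.trans (half_lt_decayRate hκ l)).le (re_max_add_nonneg hw x))

theorem symbolNorm_le (hκ : 0 < κ) (hχ : Summable fun l => ‖χ l‖) {w : ℂ}
    (hw : 0 ≤ w.re) (x : ℝ) (hx : 0 < x) :
    symbolNorm κ χ w x ≤ (∑' l, ‖matCLM (offDiagMat (χ l))‖) * Real.exp (-(1 / 2 * x)) := by
  rw [symbolNorm, ← (hasSum_symbolMat hκ hχ (re_max_add_nonneg hw x)).tsum_eq, max_eq_left hx.le]
  refine tsum_of_norm_bounded ((summable_norm_offDiag hχ).hasSum.mul_right _) fun l => ?_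
  rw [norm_smul, mul_comm, Complex.norm_exp]
  refine mul_le_mul_of_nonneg_left (Real.exp_le_exp.2 ?_) (norm_nonneg _)
  have hl := half_lt_decayRate hκ l
  simp only [Complex.neg_re, Complex.mul_re, Complex.ofReal_re, Complex.add_re,
    Complex.ofReal_im, zero_mul, sub_zero]
  nlinarith [mul_nonneg (one_half_pos.trans hl).le hw]

theorem integrableOn_symbolNorm (hκ : 0 < κ) (hχ : Summable fun l => ‖χ l‖) {w : ℂ}
    (hw : 0 ≤ w.re) : IntegrableOn (fun x => x * symbolNorm κ χ w x ^ 2) (Ioi 0) :=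
  integrableOn_mul_sq_of_le_exp (continuous_symbolNorm hκ hχ hw) (fun _ => norm_nonneg _)
    (symbolNorm_le hκ hχ hw)

theorem integral_symbolNorm (w : ℂ) :
    ∫ x in Ioi (0 : ℝ), x * symbolNorm κ χ w x ^ 2 =
      ∫ x in Ioi (0 : ℝ), x * ‖matCLM (symbolMat κ χ (x + w))‖ ^ 2 :=
  setIntegral_congr_fun measurableSet_Ioi fun x hx => by
    simp only [symbolNorm_of_nonneg w (le_of_lt hx)]

theorem norm_scatteringOp_sq_le (hχ : Summable fun l => ‖χ l‖) {s : ℂ} (hs : 0 ≤ s.re) :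
    ‖scatteringOp hκ χ s‖ ^ 2 ≤
      ∫ x in Ioi (0 : ℝ), x * ‖matCLM (symbolMat κ χ (x + 2 * s))‖ ^ 2 := by
  rw [← integral_symbolNorm]
  have hs2 := two_mul_re_nonneg hs
  refine (isHankelOp_scatteringOp hκ hχ hs).norm_sq_le (continuous_symbolNorm hκ hχ hs2)
    (fun _ => norm_nonneg _) (fun x hx => ?_) (integrableOn_symbolNorm hκ hχ hs2)
  exact (symbolNorm_of_nonneg (2 * s) hx.le).ge

theorem integral_symbol_shift_le (hκ : 0 < κ) (hχ : Summable fun l => ‖χ l‖) {s : ℝ}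
    (hs : 0 ≤ s) :
    ∫ x in Ioi (0 : ℝ), x * ‖matCLM (symbolMat κ χ (x + 2 * (s : ℂ)))‖ ^ 2 ≤
      ∫ x in Ioi (0 : ℝ), x * ‖matCLM (symbolMat κ χ (x + s))‖ ^ 2 := by
  have hs1 : 0 ≤ (s : ℂ).re := by simpa using hs
  -- For real s, x + 2s = (x + s) + s is a translation of the real variable.
  have hEq : EqOn (fun x : ℝ => x * symbolNorm κ χ (2 * s) x ^ 2)
      (fun x => x * symbolNorm κ χ s (x + s) ^ 2) (Ioi 0) := fun x hx => by
    have hx0 : 0 ≤ x := le_of_lt hx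
    simp only
    rw [symbolNorm_of_nonneg _ hx0, symbolNorm_of_nonneg _ (add_nonneg hx0 hs)]
    congr 5
    push_cast
    ring
  rw [← integral_symbolNorm, ← integral_symbolNorm, setIntegral_congr_fun measurableSet_Ioi hEq]
  exact integral_mul_shift_le hs (integrableOn_symbolNorm hκ hχ hs1)
    ((integrableOn_symbolNorm hκ hχ (two_mul_re_nonneg hs1)).congr_fun hEq measurableSet_Ioi)

theorem norm_constMulOp_le (σ : Matrix (Fin m ⊕ Unit) (Fin m ⊕ Unit) ℂ) :
    ‖constMulOp σ‖ ≤ ‖matCLM σ‖ :=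
  ContinuousLinearMap.norm_compLpL_le _

end ScatteringNorm

/-! ### The tau function and the potential -/

section Tau

variable {m : ℕ} {κ : ℝ} (hκ : 0 < κ) {χ : ℕ → EuclideanSpace ℂ (Fin m)}
  (σ : Matrix (Fin m ⊕ Unit) (Fin m ⊕ Unit) ℂ)

/-- The expansion of `det (I - K_s)` in an explicit nuclear expansion of `K_s`. -/
noncomputable def scatteringTau (hκ : 0 < κ) (χ : ℕ → EuclideanSpace ℂ (Fin m))
    (σ : Matrix (Fin m ⊕ Unit) (Fin m ⊕ Unit) ℂ) (s : ℂ) : ℂ :=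
  hankelTau (half_lt_decayRate hκ) (fun l => matCLM (offDiagMat (χ l))) (constMulOp σ) s

theorem hasFredholmDet_kernelOp (hχ : Summable fun l => ‖χ l‖) {s : ℂ} (hs : 0 ≤ s.re) :
    HasFredholmDet (kernelOp κ χ σ s) (scatteringTau hκ χ σ s) := by
  rw [kernelOp_eq hκ hχ σ hs]
  exact hasFredholmDet_hankelTau _ (summable_norm_offDiag hχ) _ hs

theorem tauFun_two_mul (hχ : Summable fun l => ‖χ l‖) {s : ℂ} (hs : 0 ≤ s.re) :
    tauFun κ χ σ (2 * s) = scatteringTau hκ χ σ s := by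
  rw [tauFun, mul_div_cancel_left₀ s two_ne_zero]
  exact (hasFredholmDet_kernelOp hκ σ hχ hs).fredholmDet_eq

theorem tauFun_ofReal (hχ : Summable fun l => ‖χ l‖) {t : ℝ} (ht : 0 ≤ t) :
    tauFun κ χ σ t = scatteringTau hκ χ σ (t / 2 : ℝ) := by
  rw [← tauFun_two_mul hκ σ hχ (by rw [Complex.ofReal_re]; positivity)]
  congr 1
  push_cast
  ring

/-- Used with three choices of (Q, P): (P_t, 1) for the identity in (i), (P_t, P_t) for a
compression to which positivity applies, and (P_t', P_t) with t ≤ t' for monotonicity. -/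
theorem hasFredholmDet_cutoff_kernelOp (hκ : 0 < κ) (hχ : Summable fun l => ‖χ l‖) {t : ℝ} (ht : 0 ≤ t)
    (Q P : L2HalfLine (Fin m ⊕ Unit) →L[ℂ] L2HalfLine (Fin m ⊕ Unit))
    (hPQ : P ∘L Q = cutoffProj (Fin m ⊕ Unit) t) :
    HasFredholmDet (Q ∘L kernelOp κ χ σ 0 ∘L P) (tauFun κ χ σ t) := by
  rw [tauFun_ofReal hκ σ hχ ht, kernelOp_eq hκ hχ σ (by simp)]
  exact hasFredholmDet_cutoff _ (summable_norm_offDiag hχ) _ ht Q P hPQ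

theorem analyticOnNhd_tauFun (hκ : 0 < κ) (hχ : Summable fun l => ‖χ l‖) :
    AnalyticOnNhd ℂ (fun s : ℂ => tauFun κ χ σ (2 * s)) {s : ℂ | 0 < s.re} := by
  refine DifferentiableOn.analyticOnNhd ?_ (isOpen_lt continuous_const Complex.continuous_re)
  exact (differentiableOn_hankelTau (half_lt_decayRate hκ) (summable_norm_offDiag hχ)
    (constMulOp σ)).congr fun s hs => tauFun_two_mul hκ σ hχ (le_of_lt hs)

theorem tendsto_tauFun (hκ : 0 < κ) (hχ : Summable fun l => ‖χ l‖) :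
    Tendsto (fun t : ℝ => tauFun κ χ σ t) atTop (𝓝 1) := by
  have h := tendsto_hankelTau (half_lt_decayRate hκ) (summable_norm_offDiag hχ) (constMulOp σ)
    (u := fun t : ℝ => ((t / 2 : ℝ) : ℂ)) (L := atTop)
    (tendsto_id.atTop_div_const two_pos)
  refine h.congr' ?_
  filter_upwards [eventually_ge_atTop 0] with t ht
  exact (tauFun_ofReal hκ σ hχ ht).symm

/-- Zeros accumulating at s would force τ to vanish on the connected half-plane, against its limit 1
at infinity. -/
theorem eventually_tauFun_ne_zero (hκ : 0 < κ) (hχ : Summable fun l => ‖χ l‖) {s : ℂ}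
    (hs : 0 < s.re) : ∀ᶠ z in 𝓝[≠] s, tauFun κ χ σ (2 * z) ≠ 0 := by
  by_contra hne
  have hfreq : ∃ᶠ z in 𝓝[≠] s, tauFun κ χ σ (2 * z) = 0 := by
    exact (not_eventually.1 hne).mono fun z hz => not_not.1 hz
  have hzero := (analyticOnNhd_tauFun σ hκ hχ).eqOn_zero_of_preconnected_of_frequently_eq_zero
    (convex_halfSpace_re_gt 0).isPreconnected hs hfreq
  have hlim : Tendsto (fun t : ℝ => tauFun κ χ σ t) atTop (𝓝 0) := by
    refine tendsto_const_nhds.congr' ?_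
    filter_upwards [eventually_gt_atTop 0] with t ht
    have h1 : ((t / 2 : ℝ) : ℂ) ∈ {s : ℂ | 0 < s.re} := by
      rw [mem_ofPred_eq, Complex.ofReal_re]
      positivity
    have h2 := hzero h1
    simp only [Pi.zero_apply] at h2
    rw [← h2]
    congr 1
    push_cast
    ring
  exact zero_ne_one (tendsto_nhds_unique hlim (tendsto_tauFun σ hκ hχ))

theorem tauFun_ne_zero (hκ : 0 < κ) (hχ : Summable fun l => ‖χ l‖) {s : ℂ} (hs : 0 ≤ s.re)
    (h : ‖matCLM σ‖ *
      (∫ x in Ioi (0 : ℝ), x * ‖matCLM (symbolMat κ χ ((x : ℂ) + 2 * s))‖ ^ 2) < 1) :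
    tauFun κ χ σ (2 * s) ≠ 0 := by
  rw [tauFun_two_mul hκ σ hχ hs]
  refine hankelTau_ne_zero _ (summable_norm_offDiag hχ) _ hs (lt_of_le_of_lt ?_ h)
  exact mul_le_mul (norm_constMulOp_le σ) (norm_scatteringOp_sq_le hκ hχ hs) (sq_nonneg _)
    (norm_nonneg _)

theorem analyticAt_potential (hκ : 0 < κ) (hχ : Summable fun l => ‖χ l‖) {s : ℂ}
    (hs : 0 < s.re) (h : tauFun κ χ σ (2 * s) ≠ 0) : AnalyticAt ℂ (potential κ χ σ) s := by
  have h1 := analyticOnNhd_tauFun σ hκ hχ s hs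
  exact analyticAt_const.mul (h1.deriv.div h1 h).deriv

theorem meromorphicOn_potential (hκ : 0 < κ) (hχ : Summable fun l => ‖χ l‖) :
    MeromorphicOn (potential κ χ σ) {s : ℂ | 0 < s.re} := by
  intro s hs
  have h1 := (analyticOnNhd_tauFun σ hκ hχ s hs).meromorphicAt
  exact (MeromorphicAt.const (-2) s).mul (h1.deriv.div h1).deriv

theorem isPositive_compression {H : Type*} [NormedAddCommGroup H] [InnerProductSpace ℂ H]
    [CompleteSpace H] {K P : H →L[ℂ] H} (hP : IsStarProjection P) (hK : K.IsPositive) :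
    (P ∘L K ∘L P).IsPositive := by
  have := hK.conj_adjoint P
  rwa [hP.isSelfAdjoint.adjoint_eq] at this

theorem isPositive_one_sub_compression {H : Type*} [NormedAddCommGroup H]
    [InnerProductSpace ℂ H] [CompleteSpace H] {K P : H →L[ℂ] H} (hP : IsStarProjection P)
    (hK : (1 - K).IsPositive) : (1 - P ∘L K ∘L P).IsPositive := by
  -- 1 - PKP = (1 - P) + P(1 - K)P.
  have h1 := (ContinuousLinearMap.IsPositive.of_isStarProjection hP.one_sub).add
    (isPositive_compression hP hK)
  convert h1 using 1
  have h2 : P * P = P := hP.isIdempotentElem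
  change 1 - P * (K * P) = 1 - P + P * ((1 - K) * P)
  rw [sub_mul, one_mul, mul_sub, h2]
  abel

theorem cutoffProj_comp' {n : Type} [Fintype n] {t t' : ℝ} (h : t ≤ t') :
    cutoffProj n t ∘L cutoffProj n t' = cutoffProj n t' := by
  have := congrArg ContinuousLinearMap.adjoint (cutoffProj_comp (n := n) h)
  rwa [ContinuousLinearMap.adjoint_comp, adjoint_cutoffProj, adjoint_cutoffProj] at this

theorem tauFun_nonneg_of_isPositive (hκ : 0 < κ) (hχ : Summable fun l => ‖χ l‖)
    (h1 : (1 - kernelOp κ χ σ 0).IsPositive) {t : ℝ} (ht : 0 ≤ t) :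
    (tauFun κ χ σ t).im = 0 ∧ 0 ≤ (tauFun κ χ σ t).re := by
  have h := (hasFredholmDet_cutoff_kernelOp σ hκ hχ ht (cutoffProj _ t) (cutoffProj _ t)
    (cutoffProj_comp le_rfl)).nonneg
    (isPositive_one_sub_compression (isStarProjection_cutoffProj t) h1)
  rw [Complex.nonneg_iff] at h
  exact ⟨h.2.symm, h.1⟩

theorem monotoneOn_tauFun (hκ : 0 < κ) (hχ : Summable fun l => ‖χ l‖)
    (h0 : (kernelOp κ χ σ 0).IsPositive) (h1 : (1 - kernelOp κ χ σ 0).IsPositive) :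
    MonotoneOn (fun t : ℝ => (tauFun κ χ σ t).re) (Ioi 0) := by
  intro t ht t' ht' htt
  have hP := isStarProjection_cutoffProj (n := Fin m ⊕ Unit) t
  -- The operator T = P_t K P_t has determinant τ(t), and P_t' T = P_t' K P_t has determinant τ(t').
  refine (hasFredholmDet_cutoff_kernelOp σ hκ hχ (le_of_lt ht) (cutoffProj _ t) (cutoffProj _ t)
    (cutoffProj_comp le_rfl)).re_le_comp_projection ?_
    (isPositive_compression hP h0) (isPositive_one_sub_compression hP h1)
    (isStarProjection_cutoffProj t')
  have h2 := hasFredholmDet_cutoff_kernelOp σ hκ hχ (le_of_lt ht') (cutoffProj _ t')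
    (cutoffProj _ t) (cutoffProj_comp' htt)
  rw [← ContinuousLinearMap.comp_assoc, cutoffProj_comp htt]
  exact h2

end Tau

theorem proposition9p1 (m : ℕ) (κ : ℝ) (hκ : 0 < κ)
    (χ : ℕ → EuclideanSpace ℂ (Fin m)) (hχ : Summable fun l => ‖χ l‖)
    (σ : Matrix (Fin m ⊕ Unit) (Fin m ⊕ Unit) ℂ) :
    -- the Hankel operators are bounded, the `K_s` are of trace class, `τ (2 s) = det (I - K_s)`
    (∀ s : ℂ, 0 ≤ s.re →
      IsHankelOp (shiftedSymbol κ χ s) (hankelOp (shiftedSymbol κ χ s)) ∧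
      IsHankelOp (shiftedSymbolStar κ χ s) (hankelOp (shiftedSymbolStar κ χ s)) ∧
      HasFredholmDet (kernelOp κ χ σ s) (tauFun κ χ σ (2 * s))) ∧
    -- (i)
    AnalyticOnNhd ℂ (fun s : ℂ => tauFun κ χ σ (2 * s)) {s : ℂ | 0 < s.re} ∧
    (∀ s : ℝ, 0 < s →
      HasFredholmDet (cutoffProj (Fin m ⊕ Unit) (2 * s) ∘L kernelOp κ χ σ 0)
        (tauFun κ χ σ (2 * (s : ℂ)))) ∧
    -- (ii)
    (∀ s : ℂ, 0 < s.re → ∀ᶠ z in 𝓝[≠] s, tauFun κ χ σ (2 * z) ≠ 0) ∧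
    MeromorphicOn (potential κ χ σ) {s : ℂ | 0 < s.re} ∧
    (∀ s : ℂ, 0 < s.re →
      ‖matCLM σ‖ * (∫ x in Ioi (0 : ℝ), x * ‖matCLM (symbolMat κ χ ((x : ℂ) + 2 * s))‖ ^ 2) < 1 →
      tauFun κ χ σ (2 * s) ≠ 0 ∧ AnalyticAt ℂ (potential κ χ σ) s) ∧
    (∀ s : ℝ, 0 < s →
      ‖matCLM σ‖ * (∫ x in Ioi (0 : ℝ), x * ‖matCLM (symbolMat κ χ ((x : ℂ) + s))‖ ^ 2) < 1 →
      tauFun κ χ σ (2 * (s : ℂ)) ≠ 0 ∧ AnalyticAt ℂ (potential κ χ σ) s) ∧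
    -- (iii)
    ((kernelOp κ χ σ 0).IsPositive → (1 - kernelOp κ χ σ 0).IsPositive →
      (∀ t : ℝ, 0 < t → (tauFun κ χ σ t).im = 0 ∧ 0 ≤ (tauFun κ χ σ t).re) ∧
      MonotoneOn (fun t : ℝ => (tauFun κ χ σ t).re) (Ioi 0) ∧
      Tendsto (fun t : ℝ => tauFun κ χ σ t) atTop (𝓝 1)) := by
  refine ⟨fun s hs => ⟨?_, ?_, ?_⟩, analyticOnNhd_tauFun σ hκ hχ, fun s hs => ?_,
    fun s hs => eventually_tauFun_ne_zero σ hκ hχ hs, meromorphicOn_potential σ hκ hχ,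
    fun s hs h => ?_, fun s hs h => ?_, fun h0 h1 => ⟨fun t ht => ?_, ?_, ?_⟩⟩
  · rw [hankelOp_shiftedSymbol hκ hχ hs]
    exact isHankelOp_scatteringOp hκ hχ hs
  · rw [shiftedSymbolStar_eq, hankelOp_shiftedSymbol hκ hχ hs]
    exact isHankelOp_scatteringOp hκ hχ hs
  · rw [tauFun_two_mul hκ σ hχ hs]
    exact hasFredholmDet_kernelOp hκ σ hχ hs
  · have h := hasFredholmDet_cutoff_kernelOp σ hκ hχ (t := 2 * s) (by positivity)
      (cutoffProj _ (2 * s)) 1 (ContinuousLinearMap.id_comp _)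
    rw [Complex.ofReal_mul, Complex.ofReal_ofNat] at h
    exact h
  · have hne := tauFun_ne_zero σ hκ hχ (le_of_lt hs) h
    exact ⟨hne, analyticAt_potential σ hκ hχ hs hne⟩
  · have hs' : 0 < (s : ℂ).re := by simpa using hs
    have hne := tauFun_ne_zero σ hκ hχ hs'.le (lt_of_le_of_lt
      (mul_le_mul_of_nonneg_left (integral_symbol_shift_le hκ hχ hs.le) (norm_nonneg _)) h)
    exact ⟨hne, analyticAt_potential σ hκ hχ hs' hne⟩
  · exact tauFun_nonneg_of_isPositive σ hκ hχ h1 (le_of_lt ht)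
  · exact monotoneOn_tauFun σ hκ hχ h0 h1
  · exact tendsto_tauFun σ hκ hχ
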